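/- \textbf{Theorem (Existence).} Let $H\in(1/2,1)$ and let $B^H=(B^H_t)_{t\ge 0}$ be a fractional Brownian motion with Hurst parameter $H$ on a probability space, i.e. a centred Gaussian process with a.s. continuous paths and $\mathbb E(B^H_tB^H_s)=\frac12\left(t^{2H}+s^{2H}-|t-s|^{2H}\right)$. Let $\alpha\in(0,1)$, $x_0\in\mathbb R$, $T>0$, $\gamma\in(1/2,H)$ and $\sigma(x)=\frac1\alpha 1_{\{x\ge 0\}}+\frac1{1-\alpha}1_{\{x<0\}}$. Then there exists a stochastic process $x$ such that, almost surely, $x\in C^{\gamma}([0,T])$ and $$x_t=x_0+\int_0^t\sigma(x_s)\,dB^H_s\qquad\text{for all } t\in[0,T],$$ where the integral exists pathwise in the sense of Z\"ahle (generalized Young integral) at every fractional order $\beta\in(1-\gamma,\gamma)$. Here, for $\beta\in(0,1)$ and $a<b$, we say that $\int_a^b f\,dg$ exists at order $\beta$ if for some $p>1$ one has $f\in L^p([a,b])$, $g^{b-}:=g-g(b-)\in L^p([a,b])$, the fractional derivatives $D^{\beta}_{a+}f$ and $D^{1-\beta}_{b-}g^{b-}$ exist in $L^p([a,b])$, and their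 product is in $L^1([a,b])$; then $$\int_a^b f\,dg:=-\int_a^b D^{\beta}_{a+}f(r)\,D^{1-\beta}_{b-}g^{b-}(r)\,dr .$$ The fractional derivatives are the $L^p([a,b])$-limits as $\varepsilon\downarrow0$ $$D^{\beta}_{a+}f(t)=\lim_{\varepsilon\downarrow 0}\frac1{\Gamma(1-\beta)}\left(\frac{f(t)}{(t-a)^\beta}+\beta\int_a^{t-\varepsilon}\frac{f(t)-f(r)}{(t-r)^{1+\beta}}\,dr\right),$$ $$D^{\beta}_{b-}f(t)=\lim_{\varepsilon\downarrow 0}\frac1{\Gamma(1-\beta)}\left(\frac{f(t)}{(b-t)^\beta}+\beta\int_{t+\varepsilon}^{b}\frac{f(t)-f(r)}{(r-t)^{1+\beta}}\,dr\right),$$ where $f$ is set to $0$ outside $[a,b]$ and the inner integrals are oriented. For $a=b$ the integral is $0$. -/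

import Mathlib

open MeasureTheory ProbabilityTheory Filter Topology
open scoped NNReal ENNReal

noncomputable section

/-- `B` is a fractional Brownian motion on `[0, ∞)` with Hurst parameter `H`: a centred Gaussian
process with covariance `(t ^ (2H) + s ^ (2H) - |t - s| ^ (2H)) / 2` and almost surely continuous
paths. -/
structure IsFractionalBrownianMotion {Ω : Type*} [MeasurableSpace Ω] (H : ℝ) (B : ℝ≥0 → Ω → ℝ)
    (P : Measure Ω) : Prop where
  isGaussianProcess : IsGaussianProcess B P
  integral_eq_zero : ∀ t, ∫ ω, B t ω ∂P = 0
  integral_mul : ∀ s t : ℝ≥0, ∫ ω, B t ω * B s ω ∂P =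
    (1 / 2) * ((t : ℝ) ^ (2 * H) + (s : ℝ) ^ (2 * H) - |(t : ℝ) - (s : ℝ)| ^ (2 * H))
  ae_continuous : ∀ᵐ ω ∂P, Continuous fun t => B t ω

/-- The discontinuous coefficient: `1 / α` on `[0, ∞)` and `1 / (1 - α)` on `(-∞, 0)`. -/
def skewCoeff (α x : ℝ) : ℝ := if 0 ≤ x then 1 / α else 1 / (1 - α)

/-- A path on `[0, ∞)`, read as a function of a real variable (constant on `(-∞, 0]`, which
plays no role below). -/
def realPath (u : ℝ≥0 → ℝ) : ℝ → ℝ := fun s => u s.toNNReal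

/-- The `ε`-truncated left fractional derivative of order `β` of `f` on `[a, b]`. The function is
extended by `0` outside `[a, b]`, and the integral is the oriented one, so that for `t < a + ε` the
expression is the usual one, `f t / (Γ(1 - β) * ε ^ β)`. -/
def truncLeftFracDeriv (β a b : ℝ) (f : ℝ → ℝ) (ε t : ℝ) : ℝ :=
  (Real.Gamma (1 - β))⁻¹ * (f t / (t - a) ^ β +
    β * ∫ r in a..(t - ε), (f t - (Set.Icc a b).indicator f r) / (t - r) ^ (1 + β))

/-- The `ε`-truncated right fractional derivative of order `β` of `f` on `[a, b]`, with the same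
conventions. -/
def truncRightFracDeriv (β a b : ℝ) (f : ℝ → ℝ) (ε t : ℝ) : ℝ :=
  (Real.Gamma (1 - β))⁻¹ * (f t / (b - t) ^ β +
    β * ∫ r in (t + ε)..b, (f t - (Set.Icc a b).indicator f r) / (r - t) ^ (1 + β))

/-- `φ` is the left fractional derivative of order `β` of `f ∈ L^p([a, b])`: the limit in
`L^p([a, b])` of the truncated derivatives as `ε ↓ 0`. -/
def HasLeftFracDeriv (p β a b : ℝ) (f φ : ℝ → ℝ) : Prop :=
  MemLp f (ENNReal.ofReal p) (volume.restrict (Set.Icc a b)) ∧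
  MemLp φ (ENNReal.ofReal p) (volume.restrict (Set.Icc a b)) ∧
  Tendsto (fun ε => eLpNorm (fun t => truncLeftFracDeriv β a b f ε t - φ t) (ENNReal.ofReal p)
    (volume.restrict (Set.Icc a b))) (𝓝[>] 0) (𝓝 0)

/-- `φ` is the right fractional derivative of order `β` of `f ∈ L^p([a, b])`. -/
def HasRightFracDeriv (p β a b : ℝ) (f φ : ℝ → ℝ) : Prop :=
  MemLp f (ENNReal.ofReal p) (volume.restrict (Set.Icc a b)) ∧
  MemLp φ (ENNReal.ofReal p) (volume.restrict (Set.Icc a b)) ∧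
  Tendsto (fun ε => eLpNorm (fun t => truncRightFracDeriv β a b f ε t - φ t) (ENNReal.ofReal p)
    (volume.restrict (Set.Icc a b))) (𝓝[>] 0) (𝓝 0)

/-- `f` is integrable with respect to `g` on `[a, b]` in the sense of Zähle, at fractional order
`β`, and the integral `∫_a^b f dg` equals `I`. Here `g^{b-} = g - g(b-)`. The sign is the product
`(-1)^β (-1)^(1 - β) = -1` of the classical normalisation; with it `∫_a^b 1 dg = g(b) - g(a)`. -/
def HasZahleIntegral (β a b : ℝ) (f g : ℝ → ℝ) (I : ℝ) : Prop :=
  ∃ p : ℝ, 1 < p ∧ ∃ φ ψ : ℝ → ℝ,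
    HasLeftFracDeriv p β a b f φ ∧
    HasRightFracDeriv p (1 - β) a b (fun r => g r - Function.leftLim g b) ψ ∧
    IntegrableOn (fun r => φ r * ψ r) (Set.Icc a b) volume ∧
    I = -∫ r in Set.Icc a b, φ r * ψ r

end

/-- The left fractional derivative of order `β` on `[0, ∞)` in Marchaud's form, where the singular
integral is a Lebesgue integral up to the singularity. -/
noncomputable def marchaudDeriv (β : ℝ) (u : ℝ → ℝ) (s : ℝ) : ℝ :=
  (Real.Gamma (1 - β))⁻¹ * (u s / s ^ β +
    β * ∫ r in (0 : ℝ)..s, (u s - u r) / (s - r) ^ (1 + β))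

lemma intervalIntegrable_sub_rpow {e : ℝ} (he : -1 < e) (s a b : ℝ) :
    IntervalIntegrable (fun r => (s - r) ^ e) volume a b := by
  have h := (intervalIntegral.intervalIntegrable_rpow' (a := s - a) (b := s - b) he).comp_sub_left s
  simpa using h

lemma integral_sub_rpow {e : ℝ} (he : -1 < e) (a s : ℝ) :
    ∫ r in a..s, (s - r) ^ e = (s - a) ^ (e + 1) / (e + 1) := by
  rw [intervalIntegral.integral_comp_sub_left (fun x => x ^ e) s, integral_rpow (Or.inl he), sub_self,
    Real.zero_rpow (by linarith), sub_zero]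

lemma abs_div_rpow_le_of_holder {β κ K s r x : ℝ} (hr : r < s) (h : |x| ≤ K * (s - r) ^ κ) :
    ‖x / (s - r) ^ (1 + β)‖ ≤ K * (s - r) ^ (κ - 1 - β) := by
  have hpos : 0 < s - r := sub_pos.2 hr
  rw [Real.norm_eq_abs, abs_div, abs_of_pos (Real.rpow_pos_of_pos hpos _),
    div_le_iff₀ (Real.rpow_pos_of_pos hpos _), mul_assoc, ← Real.rpow_add hpos]
  rwa [show κ - 1 - β + (1 + β) = κ by ring]

lemma intervalIntegrable_marchaud {β κ K a s : ℝ} {u : ℝ → ℝ} (hu : Measurable u) (has : a ≤ s)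
    (hβκ : β < κ) (h : ∀ r ∈ Set.Ioo a s, |u s - u r| ≤ K * (s - r) ^ κ) :
    IntervalIntegrable (fun r => (u s - u r) / (s - r) ^ (1 + β)) volume a s := by
  have hk := (intervalIntegrable_sub_rpow (e := κ - 1 - β) (by linarith) s a s).const_mul K
  rw [intervalIntegrable_iff_integrableOn_Ioo_of_le has] at hk ⊢
  refine hk.mono' (Measurable.aestronglyMeasurable (by fun_prop)) ?_
  filter_upwards [ae_restrict_mem measurableSet_Ioo] with r hr
  exact abs_div_rpow_le_of_holder hr.2 (h r hr)

lemma abs_integral_marchaud_le {β κ K a s : ℝ} {u : ℝ → ℝ} (has : a ≤ s) (hβκ : β < κ)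
    (h : ∀ r ∈ Set.Ioo a s, |u s - u r| ≤ K * (s - r) ^ κ) :
    |∫ r in a..s, (u s - u r) / (s - r) ^ (1 + β)| ≤ K * (s - a) ^ (κ - β) / (κ - β) := by
  have hk := (intervalIntegrable_sub_rpow (e := κ - 1 - β) (by linarith) s a s).const_mul K
  have h1 := intervalIntegral.norm_integral_le_of_norm_le has (μ := volume)
    (f := fun r => (u s - u r) / (s - r) ^ (1 + β)) (g := fun r => K * (s - r) ^ (κ - 1 - β)) ?_ hk
  · rw [intervalIntegral.integral_const_mul, integral_sub_rpow (by linarith)] at h1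
    rw [Real.norm_eq_abs] at h1
    convert h1 using 1
    rw [mul_div_assoc]
    congr 3 <;> ring
  · have : ∀ᵐ r ∂(volume : Measure ℝ), r ≠ s := by simp [ae_iff]
    filter_upwards [this] with r hr hr'
    have hrs : r < s := lt_of_le_of_ne hr'.2 hr
    exact abs_div_rpow_le_of_holder hrs (h r ⟨hr'.1, hrs⟩)

lemma abs_marchaudDeriv_le {β κ K s : ℝ} {u : ℝ → ℝ} (hβ : β ∈ Set.Ioo (0 : ℝ) 1) (hs : 0 < s)
    (hβκ : β < κ) (h : ∀ r ∈ Set.Ioo 0 s, |u s - u r| ≤ K * (s - r) ^ κ) :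
    |marchaudDeriv β u s| ≤
      (Real.Gamma (1 - β))⁻¹ * (|u s| * s ^ (-β) + K * s ^ (κ - β) / (κ - β)) := by
  have hΓ : 0 < (Real.Gamma (1 - β))⁻¹ := inv_pos.2 (Real.Gamma_pos_of_pos (by linarith [hβ.2]))
  have h1 := abs_integral_marchaud_le hs.le hβκ h
  rw [sub_zero] at h1
  rw [marchaudDeriv, abs_mul, abs_of_pos hΓ]
  refine mul_le_mul_of_nonneg_left ((abs_add_le _ _).trans (add_le_add (le_of_eq ?_) ?_)) hΓ.le
  · rw [abs_div, abs_of_pos (Real.rpow_pos_of_pos hs _), Real.rpow_neg hs.le, div_eq_mul_inv]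
  · rw [abs_mul, abs_of_pos hβ.1]
    refine le_trans ?_ h1
    exact mul_le_of_le_one_left (abs_nonneg _) hβ.2.le

lemma tendsto_marchaudDeriv {β κ K s : ℝ} {v : ℕ → ℝ → ℝ} {u : ℝ → ℝ}
    (hv : ∀ n, Measurable (v n)) (hs : 0 < s) (hβκ : β < κ)
    (h : ∀ n, ∀ r ∈ Set.Ioo 0 s, |v n s - v n r| ≤ K * (s - r) ^ κ)
    (hlim : ∀ᵐ r, r ∈ Set.Ioo 0 s → Tendsto (fun n => v n r) atTop (𝓝 (u r)))
    (hlims : Tendsto (fun n => v n s) atTop (𝓝 (u s))) :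
    Tendsto (fun n => marchaudDeriv β (v n) s) atTop (𝓝 (marchaudDeriv β u s)) := by
  have hk := (intervalIntegrable_sub_rpow (e := κ - 1 - β) (by linarith) s 0 s).const_mul K
  refine Tendsto.const_mul _ ((hlims.div_const _).add (Tendsto.const_mul _ ?_))
  have hne : ∀ᵐ r ∂(volume : Measure ℝ), r ≠ s := by simp [ae_iff]
  refine intervalIntegral.tendsto_integral_filter_of_dominated_convergence _ ?_ ?_ hk ?_
  · refine Eventually.of_forall fun n => ?_
    have := hv n
    exact Measurable.aestronglyMeasurable (by fun_prop)
  · refine Eventually.of_forall fun n => ?_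
    filter_upwards [hne] with r hr hr'
    rw [Set.uIoc_of_le hs.le] at hr'
    have hrs : r < s := lt_of_le_of_ne hr'.2 hr
    exact abs_div_rpow_le_of_holder hrs (h n r ⟨hr'.1, hrs⟩)
  · filter_upwards [hne, hlim] with r hr hl hr'
    rw [Set.uIoc_of_le hs.le] at hr'
    have hrs : r < s := lt_of_le_of_ne hr'.2 hr
    exact (hlims.sub (hl ⟨hr'.1, hrs⟩)).div_const _

lemma measurable_intervalIntegral_right {F : ℝ → ℝ → ℝ} (hF : Measurable (Function.uncurry F)) :
    Measurable fun s => ∫ r in (0 : ℝ)..s, F s r := by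
  have key : ∀ A : Set (ℝ × ℝ), MeasurableSet A →
      Measurable fun s => ∫ r in {r | (s, r) ∈ A}, F s r := by
    intro A hA
    have h1 : StronglyMeasurable (Function.uncurry fun s r => A.indicator (Function.uncurry F) (s, r)) :=
      (hF.indicator hA).stronglyMeasurable
    have h2 := (h1.integral_prod_right (ν := volume)).measurable
    convert h2 using 2 with s
    exact (integral_indicator (measurable_prodMk_left hA)).symm
  have h1 := key {q | 0 < q.2 ∧ q.2 ≤ q.1}
    ((measurableSet_lt measurable_const measurable_snd).inter
      (measurableSet_le measurable_snd measurable_fst))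
  have h2 := key {q | q.1 < q.2 ∧ q.2 ≤ 0}
    ((measurableSet_lt measurable_fst measurable_snd).inter
      (measurableSet_le measurable_snd measurable_const))
  exact h1.sub h2

lemma measurable_marchaudDeriv (β : ℝ) {u : ℝ → ℝ} (hu : Measurable u) :
    Measurable (marchaudDeriv β u) := by
  have : Measurable (Function.uncurry fun s r : ℝ => (u s - u r) / (s - r) ^ (1 + β)) := by
    unfold Function.uncurry
    fun_prop
  have := measurable_intervalIntegral_right this
  unfold marchaudDeriv
  fun_prop

lemma truncLeftFracDeriv_of_le {β t ε s : ℝ} (u : ℝ → ℝ) (hε : 0 < ε) (hεs : ε ≤ s) (hst : s ≤ t) :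
    truncLeftFracDeriv β 0 t u ε s = (Real.Gamma (1 - β))⁻¹ * (u s / s ^ β +
      β * ∫ r in (0 : ℝ)..(s - ε), (u s - u r) / (s - r) ^ (1 + β)) := by
  rw [truncLeftFracDeriv, sub_zero]
  congr 3
  refine intervalIntegral.integral_congr fun r hr => ?_
  rw [Set.uIcc_of_le (by linarith)] at hr
  rw [Set.indicator_of_mem (show r ∈ Set.Icc 0 t from ⟨hr.1, by linarith [hr.2]⟩)]

lemma truncLeftFracDeriv_of_lt {β t ε s : ℝ} (u : ℝ → ℝ) (hβ : 0 < β) (hs : 0 < s) (hεs : s < ε) :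
    truncLeftFracDeriv β 0 t u ε s = (Real.Gamma (1 - β))⁻¹ * (u s * ε ^ (-β)) := by
  rw [truncLeftFracDeriv, sub_zero]
  congr 1
  have h1 : ∫ r in (0 : ℝ)..(s - ε), (u s - (Set.Icc 0 t).indicator u r) / (s - r) ^ (1 + β) =
      ∫ r in (0 : ℝ)..(s - ε), u s * (s - r) ^ (-(1 + β)) := by
    refine intervalIntegral.integral_congr_ae ?_
    have hne : ∀ᵐ r ∂(volume : Measure ℝ), r ≠ 0 := by simp [ae_iff]
    filter_upwards [hne] with r hr hr'
    rw [Set.uIoc_of_ge (by linarith)] at hr'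
    have hr0 : r < 0 := lt_of_le_of_ne hr'.2 hr
    rw [Set.indicator_of_notMem (by simp [hr0]), sub_zero, Real.rpow_neg (by linarith),
      div_eq_mul_inv]
  rw [h1, intervalIntegral.integral_const_mul,
    intervalIntegral.integral_comp_sub_left (fun x => x ^ (-(1 + β))) s, sub_zero, sub_sub_cancel,
    integral_rpow (Or.inr ⟨by linarith, ?_⟩)]
  · rw [show -(1 + β) + 1 = -β by ring, Real.rpow_neg hs.le, div_eq_mul_inv]
    field_simp
    ring
  · rw [Set.uIcc_of_ge hεs.le]
    exact fun h => absurd h.1 (not_le.2 hs)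

lemma abs_truncLeftFracDeriv_sub_le {β κ K M t ε s : ℝ} {u : ℝ → ℝ} (hβ : β ∈ Set.Ioo (0 : ℝ) 1)
    (hu : Measurable u) (hs : 0 < s) (hst : s ≤ t) (hε : 0 < ε) (hβκ : β < κ) (hM : |u s| ≤ M)
    (hK : 0 ≤ K) (h : ∀ r ∈ Set.Ioo 0 s, |u s - u r| ≤ K * (s - r) ^ κ) :
    |truncLeftFracDeriv β 0 t u ε s - marchaudDeriv β u s| ≤
      (Real.Gamma (1 - β))⁻¹ * ε ^ (κ - β) * (M * s ^ (-κ) + K / (κ - β)) := by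
  have hΓ : 0 < (Real.Gamma (1 - β))⁻¹ := inv_pos.2 (Real.Gamma_pos_of_pos (by linarith [hβ.2]))
  have hM0 : 0 ≤ M := (abs_nonneg _).trans hM
  have hκβ : 0 < κ - β := sub_pos.2 hβκ
  have hsκ : 0 ≤ s ^ (-κ) := Real.rpow_nonneg hs.le _
  rcases le_or_gt ε s with hεs | hεs
  · have hint := intervalIntegrable_marchaud hu hs.le hβκ h
    have hse : s - ε ∈ Set.uIcc 0 s := by
      rw [Set.uIcc_of_le hs.le]; constructor <;> linarith
    have h1 := hint.mono_set (c := 0) (d := s - ε)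
      (Set.uIcc_subset_uIcc Set.left_mem_uIcc hse)
    have h2 := hint.mono_set (c := s - ε) (d := s)
      (Set.uIcc_subset_uIcc hse Set.right_mem_uIcc)
    rw [truncLeftFracDeriv_of_le u hε hεs hst, marchaudDeriv,
      ← intervalIntegral.integral_add_adjacent_intervals h1 h2, ← mul_sub, abs_mul, abs_of_pos hΓ,
      mul_assoc]
    refine mul_le_mul_of_nonneg_left ?_ hΓ.le
    have h3 := abs_integral_marchaud_le (β := β) (a := s - ε) (K := K) (u := u) (s := s)
      (by linarith) hβκ (fun r hr => h r ⟨by linarith [hr.1], hr.2⟩)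
    rw [sub_sub_cancel] at h3
    set I := ∫ r in (s - ε)..s, (u s - u r) / (s - r) ^ (1 + β)
    rw [show ∀ x y z : ℝ, x + β * y - (x + β * (y + z)) = -(β * z) by intros; ring, abs_neg, abs_mul,
      abs_of_pos hβ.1]
    calc β * |I| ≤ |I| := mul_le_of_le_one_left (abs_nonneg _) hβ.2.le
      _ ≤ K * ε ^ (κ - β) / (κ - β) := h3
      _ = ε ^ (κ - β) * (0 + K / (κ - β)) := by ring
      _ ≤ _ := by gcongr; positivity
  · rw [truncLeftFracDeriv_of_lt u hβ.1 hs hεs, marchaudDeriv, ← mul_sub, abs_mul, abs_of_pos hΓ,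
      mul_assoc]
    refine mul_le_mul_of_nonneg_left ?_ hΓ.le
    have h3 := abs_integral_marchaud_le hs.le hβκ h
    rw [sub_zero] at h3
    set I := ∫ r in (0 : ℝ)..s, (u s - u r) / (s - r) ^ (1 + β)
    have e1 : s ^ (κ - β) ≤ ε ^ (κ - β) := Real.rpow_le_rpow hs.le hεs.le hκβ.le
    have e2 : ε ^ (-β) ≤ s ^ (-β) := Real.rpow_le_rpow_of_nonpos hs hεs.le (by linarith [hβ.1])
    have e3 : 0 ≤ ε ^ (-β) := Real.rpow_nonneg hε.le _
    have e4 : s ^ (-β) = s ^ (-κ) * s ^ (κ - β) := by rw [← Real.rpow_add hs]; congr 1; ring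
    have e5 : |u s * ε ^ (-β) - u s / s ^ β| ≤ M * s ^ (-κ) * ε ^ (κ - β) := by
      rw [div_eq_mul_inv, ← Real.rpow_neg hs.le, ← mul_sub, abs_mul, mul_assoc]
      refine mul_le_mul hM ?_ (abs_nonneg _) hM0
      rw [abs_sub_comm, abs_of_nonneg (by linarith)]
      calc s ^ (-β) - ε ^ (-β) ≤ s ^ (-β) := by linarith
        _ = s ^ (-κ) * s ^ (κ - β) := e4
        _ ≤ _ := by gcongr
    calc |u s * ε ^ (-β) - (u s / s ^ β + β * I)|
        = |(u s * ε ^ (-β) - u s / s ^ β) - β * I| := by congr 1; ring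
      _ ≤ |u s * ε ^ (-β) - u s / s ^ β| + |β * I| := abs_sub _ _
      _ ≤ M * s ^ (-κ) * ε ^ (κ - β) + K * ε ^ (κ - β) / (κ - β) := by
        refine add_le_add e5 ?_
        rw [abs_mul, abs_of_pos hβ.1]
        calc β * |I| ≤ |I| := mul_le_of_le_one_left (abs_nonneg _) hβ.2.le
          _ ≤ K * s ^ (κ - β) / (κ - β) := h3
          _ ≤ _ := by gcongr
      _ = _ := by ring

lemma memLp_rpow_neg {p κ t : ℝ} (hp : 0 < p) (hκ : p * κ < 1) :
    MemLp (fun s : ℝ => s ^ (-κ)) (ENNReal.ofReal p) (volume.restrict (Set.Icc 0 t)) := by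
  rcases lt_or_ge t 0 with ht | ht
  · rw [Set.Icc_eq_empty (not_le.2 ht), Measure.restrict_empty]
    exact ⟨aestronglyMeasurable_zero_measure _, by simp⟩
  refine ⟨Measurable.aestronglyMeasurable (by fun_prop), ?_⟩
  refine (eLpNorm_lt_top_iff_lintegral_rpow_enorm_lt_top (by simpa using hp) (by simp)).2 ?_
  rw [ENNReal.toReal_ofReal hp.le]
  have h1 : IntegrableOn (fun s : ℝ => s ^ (-(p * κ))) (Set.Icc 0 t) := by
    rw [← intervalIntegrable_iff_integrableOn_Icc_of_le ht]
    exact intervalIntegral.intervalIntegrable_rpow' (by linarith)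
  refine lt_of_eq_of_lt (lintegral_congr_ae ?_) h1.2
  filter_upwards [ae_restrict_mem measurableSet_Icc] with s hs
  rw [Real.enorm_of_nonneg (Real.rpow_nonneg hs.1 _), Real.enorm_of_nonneg (Real.rpow_nonneg hs.1 _),
    ENNReal.ofReal_rpow_of_nonneg (Real.rpow_nonneg hs.1 _) hp.le, ← Real.rpow_mul hs.1]
  congr 2
  ring

/-- A bounded function which is Hölder continuous at almost every point, with constants in `L^p`,
has its Marchaud derivative as left fractional derivative. -/
theorem hasLeftFracDeriv_marchaudDeriv {p β κ M t : ℝ} {u K : ℝ → ℝ} (hp : 1 < p)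
    (hβ : β ∈ Set.Ioo (0 : ℝ) 1) (hβκ : β < κ) (hpκ : p * κ < 1) (hu : Measurable u)
    (hM : ∀ s ∈ Set.Icc 0 t, |u s| ≤ M)
    (hK : MemLp K (ENNReal.ofReal p) (volume.restrict (Set.Icc 0 t))) (hK0 : ∀ s, 0 ≤ K s)
    (h : ∀ᵐ s ∂(volume.restrict (Set.Icc 0 t)), ∀ r ∈ Set.Ioo 0 s, |u s - u r| ≤ K s * (s - r) ^ κ) :
    HasLeftFracDeriv p β 0 t u (marchaudDeriv β u) := by
  have hp0 : 0 < p := by linarith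
  have hκβ : 0 < κ - β := sub_pos.2 hβκ
  have hpos : ∀ᵐ s ∂(volume.restrict (Set.Icc 0 t)), 0 < s ∧ s ≤ t := by
    have hne : ∀ᵐ r ∂((volume : Measure ℝ).restrict (Set.Icc 0 t)), r ≠ 0 :=
      ae_restrict_of_ae (by simp [ae_iff])
    filter_upwards [hne, ae_restrict_mem measurableSet_Icc] with s h1 h2
    exact ⟨lt_of_le_of_ne h2.1 (Ne.symm h1), h2.2⟩
  have hQ : MemLp (fun s => M * s ^ (-κ) + K s / (κ - β)) (ENNReal.ofReal p)
      (volume.restrict (Set.Icc 0 t)) := by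
    refine ((memLp_rpow_neg hp0 hpκ).const_mul M).add ?_
    simpa [div_eq_inv_mul] using hK.const_mul (κ - β)⁻¹
  have hpβ : p * β < 1 := lt_trans (mul_lt_mul_of_pos_left hβκ hp0) hpκ
  refine ⟨?_, ?_, ?_⟩
  · refine MemLp.of_bound hu.aestronglyMeasurable M ?_
    filter_upwards [ae_restrict_mem measurableSet_Icc] with s hs using hM s hs
  · have hQ2 : MemLp (fun s => M * s ^ (-β) + (t ^ (κ - β) / (κ - β)) * K s) (ENNReal.ofReal p)
        (volume.restrict (Set.Icc 0 t)) :=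
      ((memLp_rpow_neg hp0 hpβ).const_mul M).add (hK.const_mul _)
    refine hQ2.of_le_mul (c := (Real.Gamma (1 - β))⁻¹)
      (measurable_marchaudDeriv β hu).aestronglyMeasurable ?_
    filter_upwards [hpos, h, ae_restrict_mem measurableSet_Icc] with s hs hs' hst
    have hΓ : 0 < (Real.Gamma (1 - β))⁻¹ := inv_pos.2 (Real.Gamma_pos_of_pos (by linarith [hβ.2]))
    refine (abs_marchaudDeriv_le hβ hs.1 hβκ hs').trans (mul_le_mul_of_nonneg_left ?_ hΓ.le)
    refine le_trans ?_ (le_abs_self _)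
    have e1 : s ^ (κ - β) ≤ t ^ (κ - β) := Real.rpow_le_rpow hs.1.le hs.2 hκβ.le
    have e2 : 0 ≤ s ^ (-β) := Real.rpow_nonneg hs.1.le _
    have := hK0 s
    refine add_le_add (mul_le_mul_of_nonneg_right (hM s hst) e2) ?_
    calc K s * s ^ (κ - β) / (κ - β) ≤ K s * t ^ (κ - β) / (κ - β) := by gcongr
      _ = _ := by ring
  · have hbound : ∀ ε ∈ Set.Ioi (0 : ℝ), eLpNorm
        (fun s => truncLeftFracDeriv β 0 t u ε s - marchaudDeriv β u s) (ENNReal.ofReal p)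
          (volume.restrict (Set.Icc 0 t)) ≤
        ENNReal.ofReal ((Real.Gamma (1 - β))⁻¹ * ε ^ (κ - β)) *
          eLpNorm (fun s => M * s ^ (-κ) + K s / (κ - β)) (ENNReal.ofReal p)
            (volume.restrict (Set.Icc 0 t)) := by
      intro ε hε
      refine eLpNorm_le_mul_eLpNorm_of_ae_le_mul ?_ _
      filter_upwards [hpos, h, ae_restrict_mem measurableSet_Icc] with s hs hs' hst
      have hΓ : 0 < (Real.Gamma (1 - β))⁻¹ := inv_pos.2 (Real.Gamma_pos_of_pos (by linarith [hβ.2]))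
      refine (abs_truncLeftFracDeriv_sub_le hβ hu hs.1 hs.2 hε hβκ (hM s hst) (hK0 s) hs').trans ?_
      exact mul_le_mul_of_nonneg_left (le_abs_self _)
        (mul_nonneg hΓ.le (Real.rpow_nonneg (le_of_lt hε) _))
    have hlim : Tendsto (fun ε : ℝ => ENNReal.ofReal ((Real.Gamma (1 - β))⁻¹ * ε ^ (κ - β)) *
        eLpNorm (fun s => M * s ^ (-κ) + K s / (κ - β)) (ENNReal.ofReal p)
            (volume.restrict (Set.Icc 0 t))) (𝓝[>] 0) (𝓝 0) := by
      have h1 : Tendsto (fun ε : ℝ => (Real.Gamma (1 - β))⁻¹ * ε ^ (κ - β)) (𝓝 0) (𝓝 0) := by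
        have := (Real.continuousAt_rpow_const 0 (κ - β) (Or.inr hκβ.le)).tendsto.const_mul
          ((Real.Gamma (1 - β))⁻¹)
        simpa [Real.zero_rpow hκβ.ne'] using this
      have h2 := ENNReal.tendsto_ofReal (h1.mono_left (nhdsWithin_le_nhds (s := Set.Ioi 0)))
      have h3 := ENNReal.Tendsto.mul_const h2 (Or.inr hQ.2.ne)
      simpa using h3
    refine tendsto_of_tendsto_of_tendsto_of_le_of_le' tendsto_const_nhds hlim
      (Eventually.of_forall fun _ => zero_le) ?_
    filter_upwards [self_mem_nhdsWithin] with ε hε using hbound ε hε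

lemma truncRightFracDeriv_eq {β t ε : ℝ} (g : ℝ → ℝ) (s : ℝ) :
    truncRightFracDeriv β 0 t g ε s = truncLeftFracDeriv β 0 t (fun r => g (t - r)) ε (t - s) := by
  rw [truncRightFracDeriv, truncLeftFracDeriv, sub_zero, sub_sub_cancel]
  congr 3
  have := intervalIntegral.integral_comp_sub_left (a := 0) (b := t - s - ε)
    (fun r => (g s - (Set.Icc 0 t).indicator g r) / (r - s) ^ (1 + β)) t
  rw [sub_zero, show t - (t - s - ε) = s + ε by ring] at this
  rw [← this]
  refine intervalIntegral.integral_congr fun r _ => ?_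
  have h1 : (Set.Icc 0 t).indicator g (t - r) = (Set.Icc 0 t).indicator (fun r => g (t - r)) r := by
    simp only [Set.indicator, Set.mem_Icc]
    congr 1
    exact propext ⟨fun h => ⟨by linarith [h.2], by linarith [h.1]⟩,
      fun h => ⟨by linarith [h.2], by linarith [h.1]⟩⟩
  rw [h1]
  congr 2
  ring

lemma measurePreserving_sub_left_Icc (t : ℝ) :
    MeasurePreserving (fun s => t - s) (volume.restrict (Set.Icc 0 t))
      (volume.restrict (Set.Icc 0 t)) := by
  have h := (Measure.measurePreserving_sub_left (volume : Measure ℝ) t).restrict_preimage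
    (measurableSet_Icc (a := (0 : ℝ)) (b := t))
  simpa using h

/-- Reflection exchanges left and right fractional derivatives. -/
theorem HasLeftFracDeriv.hasRightFracDeriv {p β t : ℝ} {g φ : ℝ → ℝ}
    (h : HasLeftFracDeriv p β 0 t (fun r => g (t - r)) φ) :
    HasRightFracDeriv p β 0 t g (fun s => φ (t - s)) := by
  have hmp := measurePreserving_sub_left_Icc t
  refine ⟨?_, h.2.1.comp_measurePreserving hmp, ?_⟩
  · have := h.1.comp_measurePreserving hmp
    simpa [Function.comp_def] using this
  · refine h.2.2.congr fun ε => ?_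
    have hemb : MeasurableEmbedding (fun s : ℝ => t - s) :=
      (MeasurableEquiv.subLeft t).measurableEmbedding
    have := hemb.eLpNorm_map_measure (μ := volume.restrict (Set.Icc 0 t)) (p := ENNReal.ofReal p)
      (g := fun s => truncLeftFracDeriv β 0 t (fun r => g (t - r)) ε s - φ s)
    rw [hmp.map_eq] at this
    rw [this]
    congr 1
    ext s
    simp [truncRightFracDeriv_eq]

lemma HasLeftFracDeriv.congr {p β t : ℝ} {f f' φ : ℝ → ℝ} (h : HasLeftFracDeriv p β 0 t f φ)
    (hff' : Set.EqOn f f' (Set.Icc 0 t)) : HasLeftFracDeriv p β 0 t f' φ := by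
  have hae : f =ᵐ[volume.restrict (Set.Icc 0 t)] f' := by
    filter_upwards [ae_restrict_mem measurableSet_Icc] with s hs using hff' hs
  refine ⟨(memLp_congr_ae hae).1 h.1, h.2.1, h.2.2.congr fun ε => eLpNorm_congr_ae ?_⟩
  filter_upwards [hae] with s hs
  simp only [truncLeftFracDeriv, hs, Set.indicator_congr hff']

lemma HasRightFracDeriv.congr {p β t : ℝ} {f f' φ : ℝ → ℝ} (h : HasRightFracDeriv p β 0 t f φ)
    (hff' : Set.EqOn f f' (Set.Icc 0 t)) : HasRightFracDeriv p β 0 t f' φ := by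
  have hae : f =ᵐ[volume.restrict (Set.Icc 0 t)] f' := by
    filter_upwards [ae_restrict_mem measurableSet_Icc] with s hs using hff' hs
  refine ⟨(memLp_congr_ae hae).1 h.1, h.2.1, h.2.2.congr fun ε => eLpNorm_congr_ae ?_⟩
  filter_upwards [hae] with s hs
  simp only [truncRightFracDeriv, hs, Set.indicator_congr hff']

/-- The triangle `{0 < v < s < t}`. -/
def openTriangle (t : ℝ) : Set (ℝ × ℝ) := {q | 0 < q.1 ∧ q.1 < q.2 ∧ q.2 < t}

lemma measurableSet_openTriangle (t : ℝ) : MeasurableSet (openTriangle t) :=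
  (measurableSet_lt measurable_const measurable_fst).inter
    ((measurableSet_lt measurable_fst measurable_snd).inter
      (measurableSet_lt measurable_snd measurable_const))

lemma integral_integral_triangle {F : ℝ → ℝ → ℝ} {t : ℝ} (ht : 0 ≤ t)
    (hF : Integrable ((openTriangle t).indicator (Function.uncurry F)) (volume.prod volume)) :
    ∫ v in (0 : ℝ)..t, ∫ s in v..t, F v s = ∫ s in (0 : ℝ)..t, ∫ v in (0 : ℝ)..s, F v s := by
  have h := integral_integral_swap (f := fun v s => (openTriangle t).indicator (Function.uncurry F) (v, s)) hF
  rw [intervalIntegral.integral_of_le ht, integral_Ioc_eq_integral_Ioo,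
    ← integral_indicator measurableSet_Ioo, intervalIntegral.integral_of_le ht,
    integral_Ioc_eq_integral_Ioo, ← integral_indicator measurableSet_Ioo]
  convert h using 1
  · congr 1
    ext v
    by_cases hv : v ∈ Set.Ioo 0 t
    · rw [Set.indicator_of_mem hv, intervalIntegral.integral_of_le hv.2.le,
        integral_Ioc_eq_integral_Ioo, ← integral_indicator measurableSet_Ioo]
      congr 1
      ext s
      by_cases hs : s ∈ Set.Ioo v t
      · rw [Set.indicator_of_mem hs, Set.indicator_of_mem (show (v, s) ∈ openTriangle t from
          ⟨hv.1, hs.1, hs.2⟩), Function.uncurry]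
      · rw [Set.indicator_of_notMem hs, Set.indicator_of_notMem fun h => hs ⟨h.2.1, h.2.2⟩]
    · rw [Set.indicator_of_notMem hv, eq_comm]
      refine integral_eq_zero_of_ae (Eventually.of_forall fun s => ?_)
      exact Set.indicator_of_notMem (fun h => hv ⟨h.1, h.2.1.trans h.2.2⟩) _
  · congr 1
    ext s
    by_cases hv : s ∈ Set.Ioo 0 t
    · rw [Set.indicator_of_mem hv, intervalIntegral.integral_of_le hv.1.le,
        integral_Ioc_eq_integral_Ioo, ← integral_indicator measurableSet_Ioo]
      congr 1
      ext v
      by_cases hs : v ∈ Set.Ioo 0 s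
      · rw [Set.indicator_of_mem hs, Set.indicator_of_mem (show (v, s) ∈ openTriangle t from
          ⟨hs.1, hs.2, hv.2⟩), Function.uncurry]
      · rw [Set.indicator_of_notMem hs, Set.indicator_of_notMem fun h => hs ⟨h.1, h.2.1⟩]
    · rw [Set.indicator_of_notMem hv, eq_comm]
      refine integral_eq_zero_of_ae (Eventually.of_forall fun v => ?_)
      exact Set.indicator_of_notMem (fun h => hv ⟨h.1.trans h.2.1, h.2.2⟩) _

lemma integrable_triangle_of_bound {F : ℝ → ℝ → ℝ} {G : ℝ × ℝ → ℝ} {t M : ℝ}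
    (hF : Measurable (Function.uncurry F)) (hG : Integrable G (volume.prod volume))
    (h : ∀ q ∈ openTriangle t, |F q.1 q.2| ≤ M * |G q|) (hM : 0 ≤ M) :
    Integrable ((openTriangle t).indicator (Function.uncurry F)) (volume.prod volume) := by
  refine (hG.norm.const_mul M).mono' (hF.indicator (measurableSet_openTriangle t)).aestronglyMeasurable
    (Eventually.of_forall fun q => ?_)
  by_cases hq : q ∈ openTriangle t
  · rw [Set.indicator_of_mem hq]
    exact h q hq
  · rw [Set.indicator_of_notMem hq, norm_zero]
    positivity

lemma integrable_triangle_snd {b k f : ℝ → ℝ} {t M : ℝ} (hb : Measurable b) (hk : Measurable k)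
    (hf : Measurable f) (hbM : ∀ v ∈ Set.Ioo 0 t, |b v| ≤ M) (hM : 0 ≤ M)
    (hki : IntegrableOn k (Set.Ioo 0 t)) (hfi : IntegrableOn f (Set.Ioo 0 t)) :
    Integrable ((openTriangle t).indicator (Function.uncurry fun v s => b v * k (s - v) * f s))
      (volume.prod volume) := by
  have hk' : Integrable fun x => (Set.Ioo 0 t).indicator k (-x) :=
    ((integrable_indicator_iff measurableSet_Ioo).2 hki).comp_neg
  have hf' := (integrable_indicator_iff measurableSet_Ioo).2 hfi
  refine integrable_triangle_of_bound (by unfold Function.uncurry; fun_prop)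
    (hf'.convolution_integrand (ContinuousLinearMap.mul ℝ ℝ) hk') (fun q hq => ?_) hM
  rw [ContinuousLinearMap.mul_apply',
    Set.indicator_of_mem (show q.2 ∈ Set.Ioo 0 t from ⟨hq.1.trans hq.2.1, hq.2.2⟩),
    Set.indicator_of_mem (show -(q.1 - q.2) ∈ Set.Ioo 0 t from
      ⟨by linarith [hq.2.1], by linarith [hq.1, hq.2.2]⟩), neg_sub, mul_assoc, abs_mul,
    mul_comm (f q.2)]
  exact mul_le_mul_of_nonneg_right (hbM _ ⟨hq.1, hq.2.1.trans hq.2.2⟩) (abs_nonneg _)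

lemma integrable_triangle_fst {b k f : ℝ → ℝ} {t M : ℝ} (hb : Measurable b) (hk : Measurable k)
    (hf : Measurable f) (hbM : ∀ v ∈ Set.Ioo 0 t, |b v| ≤ M) (hM : 0 ≤ M)
    (hki : IntegrableOn k (Set.Ioo 0 t)) (hfi : IntegrableOn f (Set.Ioo 0 t)) :
    Integrable ((openTriangle t).indicator (Function.uncurry fun s w => f s * (b w * k (w - s))))
      (volume.prod volume) := by
  have hk' := (integrable_indicator_iff measurableSet_Ioo).2 hki
  have hf' := (integrable_indicator_iff measurableSet_Ioo).2 hfi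
  refine integrable_triangle_of_bound (by unfold Function.uncurry; fun_prop)
    (hf'.convolution_integrand (ContinuousLinearMap.mul ℝ ℝ) hk').swap (fun q hq => ?_) hM
  rw [Function.comp_apply, ContinuousLinearMap.mul_apply', Prod.fst_swap, Prod.snd_swap,
    Set.indicator_of_mem (show q.1 ∈ Set.Ioo 0 t from ⟨hq.1, hq.2.1.trans hq.2.2⟩),
    Set.indicator_of_mem (show q.2 - q.1 ∈ Set.Ioo 0 t from
      ⟨by linarith [hq.2.1], by linarith [hq.1, hq.2.2]⟩), mul_left_comm, abs_mul]
  exact mul_le_mul_of_nonneg_right (hbM _ ⟨hq.1.trans hq.2.1, hq.2.2⟩) (abs_nonneg _)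

lemma integral_rpow_mul_rpow_sub {β : ℝ} (hβ : β ∈ Set.Ioo (0 : ℝ) 1) {v w : ℝ} (hvw : v < w) :
    ∫ s in v..w, (s - v) ^ (-β) * (w - s) ^ (β - 1) = Real.Gamma (1 - β) * Real.Gamma β := by
  have h0 : ∫ s in (0 : ℝ)..(w - v), s ^ (-β) * ((w - v) - s) ^ (β - 1) =
      Real.Gamma (1 - β) * Real.Gamma β := by
    have ha : 0 < w - v := sub_pos.2 hvw
    have h1 := Complex.betaIntegral_scaled ((1 - β : ℝ) : ℂ) (β : ℂ) ha
    have h2 := beta_eq_betaIntegralReal (1 - β) β (by linarith [hβ.2]) hβ.1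
    have h3 : ∫ x in (0 : ℝ)..(w - v), (x : ℂ) ^ (((1 - β : ℝ) : ℂ) - 1) *
        (((w - v : ℝ) : ℂ) - x) ^ ((β : ℂ) - 1) =
        ((∫ s in (0 : ℝ)..(w - v), s ^ (-β) * ((w - v) - s) ^ (β - 1) : ℝ) : ℂ) := by
      rw [← intervalIntegral.integral_ofReal]
      refine intervalIntegral.integral_congr fun x hx => ?_
      rw [Set.uIcc_of_le ha.le] at hx
      simp only [Complex.ofReal_mul]
      rw [Complex.ofReal_cpow hx.1, Complex.ofReal_cpow (by linarith [hx.2])]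
      push_cast
      congr 2
      ring
    rw [h3] at h1
    have h4 := congrArg Complex.re h1
    rw [Complex.ofReal_re, show (((1 - β : ℝ) : ℂ) + (β : ℂ) - 1) = 0 by push_cast; ring,
      Complex.cpow_zero, one_mul, ← h2] at h4
    rw [h4, beta]
    simp
  rw [← h0]
  have := intervalIntegral.integral_comp_sub_right (a := v) (b := w)
    (fun s => s ^ (-β) * ((w - v) - s) ^ (β - 1)) v
  rw [sub_self] at this
  rw [← this]
  refine intervalIntegral.integral_congr fun x _ => ?_
  simp

lemma exists_abs_sub_le_of_hasDerivAt {u u' : ℝ → ℝ} (hu : ∀ x, HasDerivAt u (u' x) x)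
    (hu' : Continuous u') (a b : ℝ) :
    ∃ K, 0 ≤ K ∧ (∀ x ∈ Set.Icc a b, |u' x| ≤ K) ∧
      ∀ x ∈ Set.Icc a b, ∀ y ∈ Set.Icc a b, |u x - u y| ≤ K * |x - y| := by
  obtain ⟨K, hK⟩ := (isCompact_Icc (a := a) (b := b)).exists_bound_of_continuousOn hu'.continuousOn
  refine ⟨max K 0, le_max_right _ _, fun x hx => (hK x hx).trans (le_max_left _ _), ?_⟩
  intro x hx y hy
  exact Convex.norm_image_sub_le_of_norm_hasDerivWithin_le (𝕜 := ℝ)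
    (fun z _ => (hu z).hasDerivWithinAt)
    (fun z hz => (hK z hz).trans (le_max_left _ _)) (convex_Icc a b) hy hx

lemma marchaudDeriv_of_hasDerivAt {β s : ℝ} {u u' : ℝ → ℝ} (hβ : β ∈ Set.Ioo (0 : ℝ) 1)
    (hu : ∀ x, HasDerivAt u (u' x) x) (hu' : Continuous u') (hs : 0 < s) :
    marchaudDeriv β u s = (Real.Gamma (1 - β))⁻¹ *
      (u 0 * s ^ (-β) + ∫ v in (0 : ℝ)..s, u' v * (s - v) ^ (-β)) := by
  have huc : Continuous u := continuous_iff_continuousAt.2 fun x => (hu x).continuousAt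
  obtain ⟨K, hK0, -, hK⟩ := exists_abs_sub_le_of_hasDerivAt hu hu' 0 s
  have hint := intervalIntegrable_marchaud (β := β) (κ := 1) (K := K) huc.measurable hs.le hβ.2
    (fun r hr => by
      have := hK s ⟨hs.le, le_rfl⟩ r ⟨hr.1.le, hr.2.le⟩
      rwa [abs_of_pos (sub_pos.2 hr.2), ← Real.rpow_one (s - r)] at this)
  have hint2 : IntervalIntegrable (fun v => u' v * (s - v) ^ (-β)) volume 0 s :=
    (intervalIntegrable_sub_rpow (by linarith [hβ.2]) s 0 s).continuousOn_mul hu'.continuousOn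
  have heq : Set.EqOn (fun r => (u s - u r) * (s - r) ^ (-β))
      (fun r => dslope u s r * (s - r) ^ (1 - β)) (Set.Icc 0 s) := by
    intro r hr
    simp only
    rcases eq_or_lt_of_le hr.2 with rfl | hrs
    · rw [sub_self, zero_mul, sub_self, Real.zero_rpow (by linarith [hβ.2]), mul_zero]
    · have hpos : 0 < s - r := sub_pos.2 hrs
      rw [dslope_of_ne _ hrs.ne, slope_def_field, show 1 - β = 1 + (-β) by ring,
        Real.rpow_add hpos, Real.rpow_one, ← mul_assoc, ← neg_sub (u s), ← neg_sub s r, neg_div_neg_eq,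
        div_mul_cancel₀ _ hpos.ne']
  have hcont : ContinuousOn (fun r => (u s - u r) * (s - r) ^ (-β)) (Set.Icc 0 s) := by
    refine ContinuousOn.congr ?_ heq
    have h1 : Continuous (dslope u s) := by
      rw [continuous_iff_continuousAt]
      intro r
      rcases eq_or_ne r s with rfl | hr
      · exact continuousAt_dslope_same.2 (hu r).differentiableAt
      · exact (continuousAt_dslope_of_ne hr).2 huc.continuousAt
    refine h1.continuousOn.mul (Continuous.continuousOn ?_)
    exact (continuous_const.sub continuous_id).rpow_const fun _ => Or.inr (by linarith [hβ.2])
  have hFTC := intervalIntegral.integral_eq_sub_of_hasDerivAt_of_le hs.le hcont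
    (f' := fun r => β * ((u s - u r) / (s - r) ^ (1 + β)) - u' r * (s - r) ^ (-β)) (fun r hr => by
      have hpos : 0 < s - r := sub_pos.2 hr.2
      have h1 : HasDerivAt (fun r => u s - u r) (-u' r) r := (hu r).const_sub _
      have h2 : HasDerivAt (fun r => s - r) (-1) r := (hasDerivAt_id r).const_sub _
      have h3 := h2.rpow_const (p := -β) (Or.inl hpos.ne')
      refine (h1.mul h3).congr_deriv ?_
      rw [show -β - 1 = -(1 + β) by ring, Real.rpow_neg hpos.le (1 + β)]
      ring) ((hint.const_mul β).sub hint2)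
  rw [intervalIntegral.integral_sub (hint.const_mul β) hint2, intervalIntegral.integral_const_mul,
    sub_self, sub_self, zero_mul, sub_zero] at hFTC
  rw [marchaudDeriv, div_eq_mul_inv, ← Real.rpow_neg hs.le]
  congr 1
  linarith

lemma abs_integral_mul_sub_rpow_le {β s K : ℝ} {f : ℝ → ℝ} (hβ : β < 1) (hs : 0 ≤ s)
    (hK : ∀ v ∈ Set.Icc 0 s, |f v| ≤ K) :
    |∫ v in (0 : ℝ)..s, f v * (s - v) ^ (-β)| ≤ K * (s ^ (1 - β) / (1 - β)) := by
  have h := intervalIntegral.norm_integral_le_of_norm_le hs (μ := volume)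
    (f := fun v => f v * (s - v) ^ (-β)) (g := fun v => K * (s - v) ^ (-β))
    (Eventually.of_forall fun v hv => by
      have h0 : 0 ≤ (s - v) ^ (-β) := Real.rpow_nonneg (by linarith [hv.2]) _
      rw [Real.norm_eq_abs, abs_mul, abs_of_nonneg h0]
      exact mul_le_mul_of_nonneg_right (hK v ⟨hv.1.le, hv.2⟩) h0)
    ((intervalIntegrable_sub_rpow (by linarith) s 0 s).const_mul K)
  rwa [intervalIntegral.integral_const_mul, integral_sub_rpow (by linarith), sub_zero,
    show -β + 1 = 1 - β by ring] at h

/-- Fractional integration inverts fractional differentiation of `C¹` functions. -/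
lemma integral_sub_rpow_mul_fracDeriv {β w : ℝ} {u u' : ℝ → ℝ} (hβ : β ∈ Set.Ioo (0 : ℝ) 1)
    (hu : ∀ x, HasDerivAt u (u' x) x) (hu' : Continuous u') (hw : 0 < w) :
    ∫ s in (0 : ℝ)..w, (u 0 * s ^ (-β) + ∫ v in (0 : ℝ)..s, u' v * (s - v) ^ (-β)) * (w - s) ^ (β - 1)
      = Real.Gamma (1 - β) * Real.Gamma β * u w := by
  set c := Real.Gamma (1 - β) * Real.Gamma β with hc
  have hc0 : c ≠ 0 := (mul_pos (Real.Gamma_pos_of_pos (by linarith [hβ.2]))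
    (Real.Gamma_pos_of_pos hβ.1)).ne'
  obtain ⟨K, hK0, hK, -⟩ := exists_abs_sub_le_of_hasDerivAt hu hu' 0 w
  have hb0 := integral_rpow_mul_rpow_sub hβ hw
  simp only [sub_zero] at hb0
  have hi1 : IntervalIntegrable (fun s : ℝ => s ^ (-β) * (w - s) ^ (β - 1)) volume 0 w := by
    by_contra h
    rw [intervalIntegral.integral_undef h] at hb0
    exact hc0 hb0.symm
  have hmeas : Measurable fun s => ∫ v in (0 : ℝ)..s, u' v * (s - v) ^ (-β) := by
    refine measurable_intervalIntegral_right (F := fun s v => u' v * (s - v) ^ (-β)) ?_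
    have := hu'.measurable
    unfold Function.uncurry
    fun_prop
  have hi2 : IntervalIntegrable
      (fun s : ℝ => (∫ v in (0 : ℝ)..s, u' v * (s - v) ^ (-β)) * (w - s) ^ (β - 1)) volume 0 w := by
    have h0 := intervalIntegrable_sub_rpow (e := β - 1) (by linarith [hβ.1]) w 0 w
    rw [intervalIntegrable_iff_integrableOn_Ioc_of_le hw.le] at h0 ⊢
    refine Integrable.bdd_mul (c := K * (w ^ (1 - β) / (1 - β))) h0 hmeas.aestronglyMeasurable ?_
    filter_upwards [ae_restrict_mem measurableSet_Ioc] with s hs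
    refine (abs_integral_mul_sub_rpow_le hβ.2 hs.1.le
      fun v hv => hK v ⟨hv.1, hv.2.trans hs.2⟩).trans ?_
    have h1 : 0 < 1 - β := by linarith [hβ.2]
    have := Real.rpow_le_rpow hs.1.le hs.2 h1.le
    gcongr
  have hswap := integral_integral_triangle hw.le (integrable_triangle_snd (t := w)
    (b := u') (k := fun x => x ^ (-β)) (f := fun s => (w - s) ^ (β - 1)) hu'.measurable
    (by fun_prop) (by fun_prop) (fun v hv => hK v ⟨hv.1.le, hv.2.le⟩) hK0
    ((intervalIntegrable_iff_integrableOn_Ioo_of_le hw.le).1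
      (intervalIntegral.intervalIntegrable_rpow' (by linarith [hβ.2])))
    ((intervalIntegrable_iff_integrableOn_Ioo_of_le hw.le).1
      (intervalIntegrable_sub_rpow (by linarith [hβ.1]) w 0 w)))
  have h2 : ∫ s in (0 : ℝ)..w, (∫ v in (0 : ℝ)..s, u' v * (s - v) ^ (-β)) * (w - s) ^ (β - 1)
      = c * (u w - u 0) := by
    simp only [intervalIntegral.integral_mul_const] at hswap
    rw [← hswap]
    have h3 : ∫ v in (0 : ℝ)..w, ∫ s in v..w, u' v * (s - v) ^ (-β) * (w - s) ^ (β - 1) =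
        ∫ v in (0 : ℝ)..w, c * u' v := by
      refine intervalIntegral.integral_congr_ae ?_
      have hne : ∀ᵐ r ∂(volume : Measure ℝ), r ≠ w := by simp [ae_iff]
      filter_upwards [hne] with v hv hv'
      rw [Set.uIoc_of_le hw.le] at hv'
      simp only [mul_assoc]
      rw [intervalIntegral.integral_const_mul, integral_rpow_mul_rpow_sub hβ
        (lt_of_le_of_ne hv'.2 hv), mul_comm]
    rw [h3, intervalIntegral.integral_const_mul, intervalIntegral.integral_eq_sub_of_hasDerivAt
      (fun x _ => hu x) (hu'.intervalIntegrable _ _)]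
  simp only [add_mul, mul_assoc (u 0)]
  rw [intervalIntegral.integral_add (hi1.const_mul _) hi2, intervalIntegral.integral_const_mul, hb0,
    h2]
  ring

lemma marchaudDeriv_reflect_of_hasDerivAt {β s t : ℝ} {g g' : ℝ → ℝ} (hβ : β ∈ Set.Ioo (0 : ℝ) 1)
    (hg : ∀ x, HasDerivAt g (g' x) x) (hg' : Continuous g') (hst : s < t) :
    marchaudDeriv (1 - β) (fun r => g (t - r) - g t) (t - s) =
      -((Real.Gamma β)⁻¹ * ∫ w in s..t, g' w * (w - s) ^ (β - 1)) := by
  have h := marchaudDeriv_of_hasDerivAt (β := 1 - β) (u := fun r => g (t - r) - g t)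
    (u' := fun r => -g' (t - r)) (s := t - s) ⟨by linarith [hβ.2], by linarith [hβ.1]⟩
    (fun x => by
      have h2 : HasDerivAt (fun r => t - r) (-1) x := (hasDerivAt_id x).const_sub _
      have := ((hg (t - x)).comp x h2).sub_const (g t)
      simpa using this) (by fun_prop) (sub_pos.2 hst)
  rw [h, sub_sub_cancel, sub_zero, sub_self, zero_mul, zero_add, ← mul_neg,
    ← intervalIntegral.integral_neg]
  have := intervalIntegral.integral_comp_sub_left (a := 0) (b := t - s)
    (fun w => -(g' w * (w - s) ^ (β - 1))) t
  rw [sub_sub_cancel, sub_zero] at this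
  rw [← this]
  congr 1
  refine intervalIntegral.integral_congr fun x _ => ?_
  rw [neg_mul, show -(1 - β) = β - 1 by ring, show t - s - x = t - x - s by ring]

/-- Fractional integration by parts for `C¹` functions. -/
theorem neg_integral_marchaudDeriv_mul_of_hasDerivAt {β t : ℝ} {u u' g g' : ℝ → ℝ}
    (hβ : β ∈ Set.Ioo (0 : ℝ) 1) (hu : ∀ x, HasDerivAt u (u' x) x) (hu' : Continuous u')
    (hg : ∀ x, HasDerivAt g (g' x) x) (hg' : Continuous g') (ht : 0 < t) :
    -∫ s in Set.Icc 0 t, marchaudDeriv β u s *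
      marchaudDeriv (1 - β) (fun r => g (t - r) - g t) (t - s) = ∫ s in (0 : ℝ)..t, u s * g' s := by
  set c := Real.Gamma (1 - β) * Real.Gamma β with hc
  have hc0 : c ≠ 0 := (mul_pos (Real.Gamma_pos_of_pos (by linarith [hβ.2]))
    (Real.Gamma_pos_of_pos hβ.1)).ne'
  set Φ : ℝ → ℝ := fun s => u 0 * s ^ (-β) + ∫ v in (0 : ℝ)..s, u' v * (s - v) ^ (-β) with hΦ
  have hmeas : Measurable fun s => ∫ v in (0 : ℝ)..s, u' v * (s - v) ^ (-β) := by
    refine measurable_intervalIntegral_right (F := fun s v => u' v * (s - v) ^ (-β)) ?_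
    have := hu'.measurable
    unfold Function.uncurry
    fun_prop
  obtain ⟨K, hK0, hK, -⟩ := exists_abs_sub_le_of_hasDerivAt hu hu' 0 t
  have hΦi : IntegrableOn Φ (Set.Ioo 0 t) := by
    refine Integrable.add (Integrable.const_mul ?_ _) ?_
    · exact (intervalIntegrable_iff_integrableOn_Ioo_of_le ht.le).1
        (intervalIntegral.intervalIntegrable_rpow' (by linarith [hβ.2]))
    · refine Measure.integrableOn_of_bounded (M := K * (t ^ (1 - β) / (1 - β))) (by simp)
        hmeas.aestronglyMeasurable ?_
      filter_upwards [ae_restrict_mem measurableSet_Ioo] with s hs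
      refine (abs_integral_mul_sub_rpow_le hβ.2 hs.1.le
        fun v hv => hK v ⟨hv.1, hv.2.trans hs.2.le⟩).trans ?_
      have h1 : 0 < 1 - β := by linarith [hβ.2]
      have := Real.rpow_le_rpow hs.1.le hs.2.le h1.le
      gcongr
  obtain ⟨K', hK'⟩ := (isCompact_Icc (a := (0 : ℝ)) (b := t)).exists_bound_of_continuousOn
    hg'.continuousOn
  have hswap := integral_integral_triangle ht.le (integrable_triangle_fst (t := t)
    (b := g') (k := fun x => x ^ (β - 1)) (f := Φ) (M := max K' 0) hg'.measurable
    (by fun_prop) (by fun_prop)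
    (fun v hv => (hK' v ⟨hv.1.le, hv.2.le⟩).trans (le_max_left _ _)) (le_max_right _ _)
    ((intervalIntegrable_iff_integrableOn_Ioo_of_le ht.le).1
      (intervalIntegral.intervalIntegrable_rpow' (by linarith [hβ.1]))) hΦi)
  simp only [intervalIntegral.integral_const_mul] at hswap
  have h1 : ∫ s in Set.Icc 0 t, marchaudDeriv β u s *
      marchaudDeriv (1 - β) (fun r => g (t - r) - g t) (t - s) =
      ∫ s in Set.Ioo 0 t, -(c⁻¹ * (Φ s * ∫ w in s..t, g' w * (w - s) ^ (β - 1))) := by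
    rw [integral_Icc_eq_integral_Ioo]
    refine setIntegral_congr_fun measurableSet_Ioo fun s hs => ?_
    rw [marchaudDeriv_of_hasDerivAt hβ hu hu' hs.1,
      marchaudDeriv_reflect_of_hasDerivAt hβ hg hg' hs.2, hc, mul_inv]
    simp only [hΦ]
    ring
  rw [h1, integral_neg, neg_neg, integral_const_mul, ← integral_Ioc_eq_integral_Ioo,
    ← intervalIntegral.integral_of_le ht.le, hswap, ← intervalIntegral.integral_const_mul]
  refine intervalIntegral.integral_congr_ae (Eventually.of_forall fun w hw => ?_)
  rw [Set.uIoc_of_le ht.le] at hw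
  have := integral_sub_rpow_mul_fracDeriv hβ hu hu' hw.1
  have h2 : ∫ s in (0 : ℝ)..w, Φ s * (g' w * (w - s) ^ (β - 1)) =
      g' w * ∫ s in (0 : ℝ)..w, Φ s * (w - s) ^ (β - 1) := by
    rw [← intervalIntegral.integral_const_mul]
    exact intervalIntegral.integral_congr fun s _ => by ring
  rw [h2, this, ← hc]
  field_simp

/-- Minus the integral of the product of the Marchaud derivatives of `u` and `g - g t`. -/
noncomputable def marchaudPairing (β t : ℝ) (u g : ℝ → ℝ) : ℝ :=
  -∫ s in Set.Icc 0 t, marchaudDeriv β u s *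
    marchaudDeriv (1 - β) (fun r => g (t - r) - g t) (t - s)

lemma continuous_of_holder {γ C : ℝ} {g : ℝ → ℝ} (hγ : 0 < γ)
    (hg : ∀ s r, |g s - g r| ≤ C * |s - r| ^ γ) : Continuous g := by
  rw [continuous_iff_continuousAt]
  intro s
  refine tendsto_iff_dist_tendsto_zero.2 ?_
  have h1 : Tendsto (fun r => C * |r - s| ^ γ) (𝓝 s) (𝓝 0) := by
    have : Continuous fun r : ℝ => C * |r - s| ^ γ :=
      continuous_const.mul ((continuous_id.sub continuous_const).abs.rpow_const fun _ => Or.inr hγ.le)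
    have h2 := this.tendsto s
    simpa [Real.zero_rpow hγ.ne'] using h2
  exact squeeze_zero (fun _ => dist_nonneg) (fun r => hg r s) h1

lemma abs_marchaudDeriv_reflect_le {β γ C t s : ℝ} {g : ℝ → ℝ} (hβ : β ∈ Set.Ioo (0 : ℝ) 1)
    (hβγ : 1 - β < γ) (hC : 0 ≤ C) (hg : ∀ s r, |g s - g r| ≤ C * |s - r| ^ γ)
    (hs : 0 ≤ s) (hst : s < t) :
    |marchaudDeriv (1 - β) (fun r => g (t - r) - g t) (t - s)| ≤
      (Real.Gamma β)⁻¹ * (C * (1 + (γ - (1 - β))⁻¹) * t ^ (γ - (1 - β))) := by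
  have hts : 0 < t - s := sub_pos.2 hst
  have h := abs_marchaudDeriv_le (β := 1 - β) (K := C) (u := fun r => g (t - r) - g t) (s := t - s)
    ⟨by linarith [hβ.2], by linarith [hβ.1]⟩ hts hβγ (fun r hr => by
      have := hg (t - (t - s)) (t - r)
      rw [show t - (t - s) - (t - r) = -(t - s - r) by ring, abs_neg,
        abs_of_pos (sub_pos.2 hr.2)] at this
      simpa using this)
  have hΓ : 0 < (Real.Gamma β)⁻¹ := inv_pos.2 (Real.Gamma_pos_of_pos hβ.1)
  rw [sub_sub_cancel (1 : ℝ)] at h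
  refine h.trans (mul_le_mul_of_nonneg_left ?_ hΓ.le)
  have h1 := hg (t - (t - s)) t
  rw [show t - (t - s) - t = -(t - s) by ring, abs_neg, abs_of_pos hts] at h1
  have hpos : 0 < γ - (1 - β) := by linarith
  have h2 : (t - s) ^ (γ - (1 - β)) ≤ t ^ (γ - (1 - β)) :=
    Real.rpow_le_rpow hts.le (by linarith) hpos.le
  have h3 : 0 ≤ (t - s) ^ (-(1 - β)) := Real.rpow_nonneg hts.le _
  calc _ ≤ C * (t - s) ^ γ * (t - s) ^ (-(1 - β)) +
        C * (t - s) ^ (γ - (1 - β)) / (γ - (1 - β)) := by gcongr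
    _ = C * (1 + (γ - (1 - β))⁻¹) * (t - s) ^ (γ - (1 - β)) := by
      rw [mul_assoc, ← Real.rpow_add hts, ← sub_eq_add_neg]; ring
    _ ≤ _ := by gcongr

lemma measurable_marchaudDeriv_reflect {β t : ℝ} {g : ℝ → ℝ} (hg : Measurable g) :
    Measurable fun s => marchaudDeriv (1 - β) (fun r => g (t - r) - g t) (t - s) :=
  (measurable_marchaudDeriv (1 - β) (by fun_prop)).comp (measurable_const.sub measurable_id)

lemma ae_restrict_Icc_mem_Ioo (t : ℝ) :
    ∀ᵐ s ∂((volume : Measure ℝ).restrict (Set.Icc 0 t)), s ∈ Set.Ioo 0 t := by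
  rw [← restrict_Ioo_eq_restrict_Icc]
  exact ae_restrict_mem measurableSet_Ioo

/-- Dominated convergence for the fractional pairing. -/
theorem tendsto_marchaudPairing {β κ γ C M t : ℝ} {v : ℕ → ℝ → ℝ} {u K : ℝ → ℝ} {gs : ℕ → ℝ → ℝ}
    {g : ℝ → ℝ} (hβ : β ∈ Set.Ioo (0 : ℝ) 1) (hβκ : β < κ) (hβγ : 1 - β < γ) (hC : 0 ≤ C)
    (hv : ∀ n, Measurable (v n)) (hM : ∀ n s, |v n s| ≤ M)
    (hK : IntegrableOn K (Set.Icc 0 t)) (hK0 : ∀ s, 0 ≤ K s)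
    (hvK : ∀ᵐ s ∂(volume.restrict (Set.Icc 0 t)),
      ∀ n, ∀ r ∈ Set.Ioo 0 s, |v n s - v n r| ≤ K s * (s - r) ^ κ)
    (hvu : ∀ᵐ s ∂(volume.restrict (Set.Icc 0 t)), Tendsto (fun n => v n s) atTop (𝓝 (u s)))
    (hgs : ∀ n s r, |gs n s - gs n r| ≤ C * |s - r| ^ γ)
    (hlim : ∀ s, Tendsto (fun n => gs n s) atTop (𝓝 (g s))) :
    Tendsto (fun n => marchaudPairing β t (v n) (gs n)) atTop (𝓝 (marchaudPairing β t u g)) := by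
  have hγ0 : 0 < γ := by linarith [hβ.2]
  have hβ1 : β < 1 := hβ.2
  have hgm : ∀ n, Measurable (gs n) := fun n => (continuous_of_holder hγ0 (hgs n)).measurable
  have hκβ : 0 < κ - β := sub_pos.2 hβκ
  set N := (Real.Gamma β)⁻¹ * (C * (1 + (γ - (1 - β))⁻¹) * t ^ (γ - (1 - β))) with hN
  have hΓ : 0 < (Real.Gamma (1 - β))⁻¹ := inv_pos.2 (Real.Gamma_pos_of_pos (by linarith [hβ.2]))
  refine Tendsto.neg (tendsto_integral_of_dominated_convergence
    (fun s => (Real.Gamma (1 - β))⁻¹ * (M * s ^ (-β) + K s * (t ^ (κ - β) / (κ - β))) * N)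
    (fun n => ?_) ?_ (fun n => ?_) ?_)
  · exact ((measurable_marchaudDeriv β (hv n)).mul
      (measurable_marchaudDeriv_reflect (hgm n))).aestronglyMeasurable
  · refine Integrable.mul_const (Integrable.const_mul (Integrable.add (Integrable.const_mul ?_ _)
      (hK.mul_const _)) _) _
    rcases lt_or_ge t 0 with ht | ht
    · simp [Set.Icc_eq_empty (not_le.2 ht)]
    · exact (intervalIntegrable_iff_integrableOn_Icc_of_le ht).1
        (intervalIntegral.intervalIntegrable_rpow' (by linarith [hβ.2]))
  · filter_upwards [ae_restrict_Icc_mem_Ioo t, hvK] with s hs hsK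
    have h1 := abs_marchaudDeriv_reflect_le hβ hβγ hC (hgs n) hs.1.le hs.2
    have h2 := abs_marchaudDeriv_le hβ hs.1 hβκ (hsK n)
    rw [norm_mul]
    have h3 : s ^ (κ - β) ≤ t ^ (κ - β) := Real.rpow_le_rpow hs.1.le hs.2.le hκβ.le
    have h4 : 0 ≤ s ^ (-β) := Real.rpow_nonneg hs.1.le _
    have h5 := hK0 s
    have hM0 : 0 ≤ M := (abs_nonneg _).trans (hM n s)
    have h6 : 0 ≤ t ^ (κ - β) := Real.rpow_nonneg (hs.1.trans hs.2).le _
    refine mul_le_mul (h2.trans (mul_le_mul_of_nonneg_left ?_ hΓ.le)) h1 (abs_nonneg _)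
      (by positivity)
    rw [← mul_div_assoc]
    gcongr
    exact hM n s
  · have hvu' := (ae_restrict_iff' measurableSet_Icc).1 hvu
    filter_upwards [ae_restrict_Icc_mem_Ioo t, hvK, hvu] with s hs hsK hsu
    refine (tendsto_marchaudDeriv hv hs.1 hβκ hsK ?_ hsu).mul
      (tendsto_marchaudDeriv (κ := γ) (K := C) (fun n => ?_) (sub_pos.2 hs.2) hβγ
        (fun n r hr => ?_) (Eventually.of_forall fun r _ => (hlim _).sub (hlim _))
        ((hlim _).sub (hlim _)))
    · filter_upwards [hvu'] with r hr hr' using hr ⟨hr'.1.le, (hr'.2.trans hs.2).le⟩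
    · have := hgm n
      fun_prop
    · have := hgs n (t - (t - s)) (t - r)
      rw [show t - (t - s) - (t - r) = -(t - s - r) by ring, abs_neg,
        abs_of_pos (sub_pos.2 hr.2)] at this
      simpa using this

/-- The forward moving average of `g` over windows of length `η`. -/
noncomputable def movingAverage (η : ℝ) (g : ℝ → ℝ) (s : ℝ) : ℝ := η⁻¹ * ∫ v in (0 : ℝ)..η, g (s + v)

lemma hasDerivAt_movingAverage (η : ℝ) {g : ℝ → ℝ} (hg : Continuous g) (s : ℝ) :
    HasDerivAt (movingAverage η g) (η⁻¹ * (g (s + η) - g s)) s := by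
  have h : movingAverage η g = fun s => η⁻¹ * ((∫ v in (0 : ℝ)..(s + η), g v) - ∫ v in (0 : ℝ)..s, g v) := by
    ext s
    rw [movingAverage, intervalIntegral.integral_comp_add_left (fun v => g v), add_zero,
      intervalIntegral.integral_interval_sub_left (hg.intervalIntegrable _ _)
        (hg.intervalIntegrable _ _)]
  have hG : ∀ x, HasDerivAt (fun y => ∫ v in (0 : ℝ)..y, g v) (g x) x := fun x =>
    intervalIntegral.integral_hasDerivAt_right (hg.intervalIntegrable _ _)
      (hg.stronglyMeasurableAtFilter _ _) hg.continuousAt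
  rw [h]
  exact (((hG (s + η)).comp_add_const s η).sub (hG s)).const_mul _

lemma abs_movingAverage_sub_le {η γ C : ℝ} {g : ℝ → ℝ} (hη : 0 < η) (hc : Continuous g)
    (hg : ∀ s r, |g s - g r| ≤ C * |s - r| ^ γ) (s r : ℝ) :
    |movingAverage η g s - movingAverage η g r| ≤ C * |s - r| ^ γ := by
  have h1 : Continuous fun v => g (s + v) := by fun_prop
  have h2 : Continuous fun v => g (r + v) := by fun_prop
  rw [movingAverage, movingAverage, ← mul_sub, ← intervalIntegral.integral_sub
    (h1.intervalIntegrable _ _) (h2.intervalIntegrable _ _), abs_mul, abs_of_pos (inv_pos.2 hη)]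
  have h := intervalIntegral.norm_integral_le_of_norm_le_const (a := 0) (b := η)
    (f := fun v => g (s + v) - g (r + v)) (C := C * |s - r| ^ γ) (fun v _ => by
      have := hg (s + v) (r + v)
      rwa [add_sub_add_right_eq_sub] at this)
  rw [sub_zero, abs_of_pos hη] at h
  rw [inv_mul_le_iff₀ hη, mul_comm η]
  exact h

lemma abs_movingAverage_sub_self_le {η γ C : ℝ} {g : ℝ → ℝ} (hη : 0 < η) (hγ : 0 ≤ γ) (hC : 0 ≤ C)
    (hc : Continuous g) (hg : ∀ s r, |g s - g r| ≤ C * |s - r| ^ γ) (s : ℝ) :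
    |movingAverage η g s - g s| ≤ C * η ^ γ := by
  have h1 : Continuous fun v => g (s + v) := by fun_prop
  have h2 : g s = η⁻¹ * ∫ v in (0 : ℝ)..η, g s := by
    rw [intervalIntegral.integral_const, sub_zero, smul_eq_mul, inv_mul_cancel_left₀ hη.ne']
  rw [movingAverage, h2, ← mul_sub, ← intervalIntegral.integral_sub
    (h1.intervalIntegrable _ _) (by simp), abs_mul, abs_of_pos (inv_pos.2 hη)]
  have h := intervalIntegral.norm_integral_le_of_norm_le_const (a := 0) (b := η)
    (f := fun v => g (s + v) - g s) (C := C * η ^ γ) (fun v hv => by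
      rw [Set.uIoc_of_le hη.le] at hv
      have := hg (s + v) s
      rw [add_sub_cancel_left, abs_of_pos hv.1] at this
      refine this.trans ?_
      have := Real.rpow_le_rpow hv.1.le hv.2 hγ
      gcongr)
  rw [sub_zero, abs_of_pos hη] at h
  rw [inv_mul_le_iff₀ hη, mul_comm η]
  exact h

/-- Chain rule for the fractional pairing: `∫ h(g) dg = F(g(t)) - F(g(0))` when `F' = h`. -/
theorem marchaudPairing_comp_eq {β γ C M Λ t : ℝ} {g h h' F : ℝ → ℝ} (hβ : β ∈ Set.Ioo (1 - γ) γ)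
    (hγ : γ < 1) (ht : 0 < t) (hC : 0 ≤ C) (hg : ∀ s r, |g s - g r| ≤ C * |s - r| ^ γ)
    (hF : ∀ x, HasDerivAt F (h x) x) (hh : ∀ x, HasDerivAt h (h' x) x) (hh' : Continuous h')
    (hM : ∀ x, |h x| ≤ M) (hΛ0 : 0 ≤ Λ) (hΛ : ∀ x y, |h x - h y| ≤ Λ * |x - y|) :
    marchaudPairing β t (fun s => h (g s)) g = F (g t) - F (g 0) := by
  have hβ' : β ∈ Set.Ioo (0 : ℝ) 1 := ⟨by linarith [hβ.1], hβ.2.trans hγ⟩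
  have hγ0 : 0 < γ := by linarith [hβ.1, hβ.2]
  have hgc := continuous_of_holder hγ0 hg
  have hhc : Continuous h := continuous_iff_continuousAt.2 fun x => (hh x).continuousAt
  have hFc : Continuous F := continuous_iff_continuousAt.2 fun x => (hF x).continuousAt
  set η : ℕ → ℝ := fun n => 1 / ((n : ℝ) + 1) with hη
  have hη0 : ∀ n, 0 < η n := fun n => Nat.one_div_pos_of_nat
  set gs : ℕ → ℝ → ℝ := fun n => movingAverage (η n) g with hgs
  have hgsd : ∀ n x, HasDerivAt (gs n) ((η n)⁻¹ * (g (x + η n) - g x)) x :=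
    fun n x => hasDerivAt_movingAverage (η n) hgc x
  have hgsc : ∀ n, Continuous (gs n) := fun n =>
    continuous_iff_continuousAt.2 fun x => (hgsd n x).continuousAt
  have hgsH : ∀ n s r, |gs n s - gs n r| ≤ C * |s - r| ^ γ :=
    fun n => abs_movingAverage_sub_le (hη0 n) hgc hg
  have hlim : ∀ s, Tendsto (fun n => gs n s) atTop (𝓝 (g s)) := by
    intro s
    rw [tendsto_iff_dist_tendsto_zero]
    have h1 : Tendsto (fun n => C * η n ^ γ) atTop (𝓝 0) := by
      have h2 := (Real.continuousAt_rpow_const 0 γ (Or.inr hγ0.le)).tendsto.comp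
        (tendsto_one_div_add_atTop_nhds_zero_nat (𝕜 := ℝ))
      have h3 := h2.const_mul C
      simpa [hη, Real.zero_rpow hγ0.ne'] using h3
    exact squeeze_zero (fun _ => dist_nonneg)
      (fun n => abs_movingAverage_sub_self_le (hη0 n) hγ0.le hC hgc hg s) h1
  have hconv := tendsto_marchaudPairing (t := t) (v := fun n s => h (gs n s)) (u := fun s => h (g s))
    (K := fun _ => Λ * C) (κ := γ) (γ := γ) (C := C) (M := M) (gs := gs) (g := g) hβ' hβ.2
    (by linarith [hβ.1]) hC (fun n => (hhc.comp (hgsc n)).measurable) (fun n s => hM _)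
    (integrable_const _) (fun _ => by positivity)
    (Eventually.of_forall fun s n r hr => by
      refine (hΛ _ _).trans ?_
      rw [mul_assoc]
      have := hgsH n s r
      rw [abs_of_pos (sub_pos.2 hr.2)] at this
      gcongr)
    (Eventually.of_forall fun s => (hhc.tendsto _).comp (hlim s)) hgsH hlim
  have hval : ∀ n, marchaudPairing β t (fun s => h (gs n s)) (gs n) = F (gs n t) - F (gs n 0) := by
    intro n
    rw [marchaudPairing, neg_integral_marchaudDeriv_mul_of_hasDerivAt (u := fun s => h (gs n s)) hβ'
      (fun x => (hh (gs n x)).comp x (hgsd n x)) (by have := hgsc n; fun_prop)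
      (hgsd n) (by fun_prop) ht]
    refine intervalIntegral.integral_eq_sub_of_hasDerivAt
      (f := fun s => F (gs n s)) (fun x _ => (hF (gs n x)).comp x (hgsd n x)) ?_
    refine Continuous.intervalIntegrable ?_ _ _
    have := hgsc n
    fun_prop
  simp only [hval] at hconv
  exact tendsto_nhds_unique hconv (((hFc.tendsto _).comp (hlim t)).sub ((hFc.tendsto _).comp (hlim 0)))

/-- A smooth approximation of the sign function. -/
noncomputable def softSign (δ x : ℝ) : ℝ := x / √(x ^ 2 + δ)

lemma abs_softSign_le_one {δ : ℝ} (hδ : 0 < δ) (x : ℝ) : |softSign δ x| ≤ 1 := by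
  rw [softSign, abs_div, abs_of_nonneg (Real.sqrt_nonneg _)]
  exact div_le_one_of_le₀ (Real.abs_le_sqrt (by linarith)) (Real.sqrt_nonneg _)

lemma abs_softSign_sub_le {δ : ℝ} (hδ : 0 < δ) (x y : ℝ) :
    |softSign δ x - softSign δ y| ≤ 2 * |x - y| / √(x ^ 2 + δ) := by
  have hX : 0 < √(x ^ 2 + δ) := Real.sqrt_pos.2 (by positivity)
  have hY : 0 < √(y ^ 2 + δ) := Real.sqrt_pos.2 (by positivity)
  have hX2 : √(x ^ 2 + δ) ^ 2 = x ^ 2 + δ := Real.sq_sqrt (by positivity)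
  have hY2 : √(y ^ 2 + δ) ^ 2 = y ^ 2 + δ := Real.sq_sqrt (by positivity)
  have hxX : |x| ≤ √(x ^ 2 + δ) := Real.abs_le_sqrt (by linarith)
  have hyY : |y| ≤ √(y ^ 2 + δ) := Real.abs_le_sqrt (by linarith)
  rw [softSign, softSign]
  set X := √(x ^ 2 + δ)
  set Y := √(y ^ 2 + δ)
  have hYX : |Y - X| ≤ |x - y| := by
    have h1 : (Y - X) * (Y + X) = (y - x) * (y + x) := by linear_combination hY2 - hX2
    have h2 : |Y - X| * (Y + X) = |y - x| * |y + x| := by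
      rw [← abs_mul, ← h1, abs_mul, abs_of_pos (add_pos hY hX)]
    have h3 : |y + x| ≤ Y + X := (abs_add_le _ _).trans (add_le_add hyY hxX)
    rw [abs_sub_comm x y]
    refine le_of_mul_le_mul_right ?_ (add_pos hY hX)
    rw [h2]
    gcongr
  have h1 : x / X - y / Y = ((x - y) + y / Y * (Y - X)) / X := by field_simp; ring
  rw [h1, abs_div, abs_of_pos hX]
  gcongr
  have h2 : |y / Y * (Y - X)| ≤ 1 * |x - y| := by
    rw [abs_mul, abs_div, abs_of_pos hY]
    exact mul_le_mul (div_le_one_of_le₀ hyY hY.le) hYX (abs_nonneg _) zero_le_one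
  linarith [abs_add_le (x - y) (y / Y * (Y - X))]

lemma hasDerivAt_sqrt_sq_add {δ : ℝ} (hδ : 0 < δ) (x : ℝ) :
    HasDerivAt (fun x => √(x ^ 2 + δ)) (softSign δ x) x := by
  have hpos : 0 < x ^ 2 + δ := by positivity
  have h := ((hasDerivAt_pow 2 x).add_const δ).sqrt hpos.ne'
  refine h.congr_deriv ?_
  rw [softSign]
  have : 0 < √(x ^ 2 + δ) := Real.sqrt_pos.2 hpos
  field_simp
  simp

lemma contDiff_softSign {δ : ℝ} (hδ : 0 < δ) : ContDiff ℝ 1 (softSign δ) := by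
  unfold softSign
  refine contDiff_id.div (ContDiff.sqrt (by fun_prop) fun x => ?_) fun x => ?_
  · positivity
  · exact (Real.sqrt_pos.2 (by positivity)).ne'

lemma le_rpow_of_le_one_of_le {d z θ : ℝ} (hz : 0 ≤ z) (hθ0 : 0 ≤ θ) (hθ : θ ≤ 1) (h1 : d ≤ 1)
    (h2 : d ≤ z) : d ≤ z ^ θ := by
  rcases le_or_gt 1 z with h | h
  · exact h1.trans (Real.one_le_rpow h hθ0)
  · rcases hz.eq_or_lt with rfl | hz0
    · exact h2.trans (Real.rpow_nonneg le_rfl _)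
    · refine h2.trans ?_
      simpa using Real.rpow_le_rpow_of_exponent_ge hz0 h.le hθ

lemma div_rpow_le_of_holder {γ C θ s r a : ℝ} {g : ℝ → ℝ} (hC : 0 ≤ C) (hθ : 0 ≤ θ)
    (hg : ∀ s r, |g s - g r| ≤ C * |s - r| ^ γ) (hrs : r < s) :
    (|g s - g r| / |g s - a|) ^ θ ≤ C ^ θ * |g s - a| ^ (-θ) * (s - r) ^ (γ * θ) := by
  have hpos : 0 < s - r := sub_pos.2 hrs
  have h := hg s r
  rw [abs_of_pos hpos] at h
  have h0 : 0 ≤ (s - r) ^ γ := Real.rpow_nonneg hpos.le _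
  rw [Real.div_rpow (abs_nonneg _) (abs_nonneg _), Real.rpow_neg (abs_nonneg _), div_eq_mul_inv,
    mul_right_comm, Real.rpow_mul hpos.le, ← Real.mul_rpow hC h0]
  have h1 := Real.rpow_le_rpow (abs_nonneg _) h hθ
  exact mul_le_mul_of_nonneg_right h1 (inv_nonneg.2 (Real.rpow_nonneg (abs_nonneg _) _))

lemma memLp_abs_sub_rpow_neg {p θ t a : ℝ} {g : ℝ → ℝ} (hg : Measurable g) (hp : 0 < p)
    (h : ∫⁻ s in Set.Icc 0 t, ENNReal.ofReal |g s - a| ^ (-(p * θ)) ≠ ⊤) (hθ : 0 < θ) :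
    MemLp (fun s => |g s - a| ^ (-θ)) (ENNReal.ofReal p) (volume.restrict (Set.Icc 0 t)) := by
  refine ⟨Measurable.aestronglyMeasurable (by fun_prop), ?_⟩
  refine (eLpNorm_lt_top_iff_lintegral_rpow_enorm_lt_top (by simpa using hp) (by simp)).2 ?_
  rw [ENNReal.toReal_ofReal hp.le]
  refine lt_of_le_of_lt (lintegral_mono fun s => ?_) (lt_top_iff_ne_top.2 h)
  have h0 : 0 ≤ |g s - a| ^ (-θ) := Real.rpow_nonneg (abs_nonneg _) _
  simp only
  rw [Real.enorm_of_nonneg h0, ENNReal.ofReal_rpow_of_nonneg h0 hp.le]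
  rcases (abs_nonneg (g s - a)).eq_or_lt with h1 | h1
  · rw [← h1, Real.zero_rpow (by linarith), Real.zero_rpow hp.ne']
    simp
  · rw [ENNReal.ofReal_rpow_of_pos h1, ← Real.rpow_mul h1.le]
    apply le_of_eq
    congr 2
    ring

lemma ae_ne_of_lintegral_rpow_neg {q t a : ℝ} {g : ℝ → ℝ} (hg : Measurable g) (hq : 0 < q)
    (h : ∫⁻ s in Set.Icc 0 t, ENNReal.ofReal |g s - a| ^ (-q) ≠ ⊤) :
    ∀ᵐ s ∂(volume.restrict (Set.Icc 0 t)), g s ≠ a := by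
  filter_upwards [ae_lt_top (by fun_prop) h] with s hs hsa
  rw [hsa, sub_self, abs_zero, ENNReal.ofReal_zero, ENNReal.zero_rpow_of_neg (by linarith)] at hs
  exact lt_irrefl _ hs

lemma ite_sub_ite_abs_le {a c₁ c₂ x y : ℝ} (hx : x ≠ a) {θ : ℝ} (hθ0 : 0 ≤ θ) :
    |(if a ≤ x then c₁ else c₂) - (if a ≤ y then c₁ else c₂)| ≤
      |c₁ - c₂| * (|x - y| / |x - a|) ^ θ := by
  have h0 : 0 ≤ |x - y| / |x - a| := by positivity
  have hxa : 0 < |x - a| := abs_pos.2 (sub_ne_zero.2 hx)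
  by_cases h : (a ≤ x ↔ a ≤ y)
  · simp only [h, sub_self, abs_zero]
    exact mul_nonneg (abs_nonneg _) (Real.rpow_nonneg h0 _)
  · have h1 : 1 ≤ |x - y| / |x - a| := by
      rw [one_le_div hxa]
      rcases le_or_gt a x with hx' | hx'
      · have hy : y < a := by
          by_contra hy
          exact h ⟨fun _ => not_lt.1 hy, fun _ => hx'⟩
        rw [abs_of_nonneg (by linarith), abs_of_nonneg (by linarith)]
        linarith
      · have hy : a ≤ y := by
          by_contra hy
          exact h ⟨fun h => absurd hx' (not_lt.2 h), fun h => absurd h hy⟩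
        rw [abs_of_nonpos (by linarith), abs_of_nonpos (by linarith)]
        linarith
    have h2 : |(if a ≤ x then c₁ else c₂) - (if a ≤ y then c₁ else c₂)| ≤ |c₁ - c₂| := by
      split_ifs <;> simp [abs_sub_comm]
    exact h2.trans (le_mul_of_one_le_right (abs_nonneg _) (Real.one_le_rpow h1 hθ0))

lemma tendsto_softSign {x : ℝ} (hx : x ≠ 0) :
    Tendsto (fun n : ℕ => softSign (1 / ((n : ℝ) + 1)) x) atTop (𝓝 (x / |x|)) := by
  have h1 : Tendsto (fun n : ℕ => √(x ^ 2 + 1 / ((n : ℝ) + 1))) atTop (𝓝 |x|) := by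
    have h2 := (tendsto_one_div_add_atTop_nhds_zero_nat (𝕜 := ℝ)).const_add (x ^ 2)
    have h3 := (Real.continuous_sqrt.tendsto _).comp h2
    rw [add_zero, Real.sqrt_sq_eq_abs] at h3
    exact h3
  exact tendsto_const_nhds.div h1 (abs_ne_zero.2 hx)

/-- The Itô–Tanaka formula for the fractional pairing along a Hölder path: no local time term
appears. -/
theorem marchaudPairing_step_eq {β γ C θ t a c₁ c₂ : ℝ} {g : ℝ → ℝ} (hβ : β ∈ Set.Ioo (1 - γ) γ)
    (hγ : γ < 1) (ht : 0 < t) (hC : 0 ≤ C) (hg : ∀ s r, |g s - g r| ≤ C * |s - r| ^ γ)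
    (hθ : θ < 1) (hβθ : β < γ * θ)
    (h : ∫⁻ s in Set.Icc 0 t, ENNReal.ofReal |g s - a| ^ (-θ) ≠ ⊤) :
    marchaudPairing β t (fun s => if a ≤ g s then c₁ else c₂) g =
      ((c₁ + c₂) / 2 * g t + (c₁ - c₂) / 2 * |g t - a|) -
      ((c₁ + c₂) / 2 * g 0 + (c₁ - c₂) / 2 * |g 0 - a|) := by
  have hβ' : β ∈ Set.Ioo (0 : ℝ) 1 := ⟨by linarith [hβ.1], hβ.2.trans hγ⟩
  have hγ0 : 0 < γ := by linarith [hβ.1, hβ.2]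
  have hθ0 : 0 < θ := by
    by_contra h0
    nlinarith [hβ'.1]
  have hgc := continuous_of_holder hγ0 hg
  set A := (c₁ + c₂) / 2
  set D := (c₁ - c₂) / 2 with hD
  set δ : ℕ → ℝ := fun n => 1 / ((n : ℝ) + 1) with hδ
  have hδ0 : ∀ n, 0 < δ n := fun n => Nat.one_div_pos_of_nat
  have hne := ae_ne_of_lintegral_rpow_neg hgc.measurable hθ0 h
  have hint : IntegrableOn (fun s => |g s - a| ^ (-θ)) (Set.Icc 0 t) := by
    have := memLp_abs_sub_rpow_neg (p := 1) hgc.measurable one_pos (by rwa [one_mul]) hθ0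
    rw [ENNReal.ofReal_one] at this
    exact memLp_one_iff_integrable.1 this
  have hss : ∀ n x, |softSign (δ n) x| ≤ 1 := fun n => abs_softSign_le_one (hδ0 n)
  have hssc : ∀ n, Continuous (softSign (δ n)) := fun n => (contDiff_softSign (hδ0 n)).continuous
  have hconv := tendsto_marchaudPairing (t := t) (v := fun n s => A + D * softSign (δ n) (g s - a))
    (u := fun s => if a ≤ g s then c₁ else c₂)
    (K := fun s => 2 * |D| * (C ^ θ * |g s - a| ^ (-θ))) (κ := γ * θ) (γ := γ) (C := C)
    (M := |A| + |D|) (gs := fun _ => g) (g := g) hβ' hβθ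
    (by linarith [hβ.1]) hC (fun n => by have := hssc n; exact (by fun_prop : Continuous _).measurable)
    (fun n s => by
      refine (abs_add_le _ _).trans ?_
      rw [abs_mul]
      have := mul_le_mul_of_nonneg_left (hss n (g s - a)) (abs_nonneg D)
      linarith)
    ((hint.const_mul _).const_mul _) (fun _ => by positivity)
    (by
      filter_upwards [hne] with s hs n r hr
      have h1 := abs_softSign_sub_le (hδ0 n) (g s - a) (g r - a)
      rw [sub_sub_sub_cancel_right] at h1
      have hsa : 0 < |g s - a| := abs_pos.2 (sub_ne_zero.2 hs)
      have h2 : |g s - a| ≤ √((g s - a) ^ 2 + δ n) := Real.abs_le_sqrt (by linarith [hδ0 n])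
      have h3 : |softSign (δ n) (g s - a) - softSign (δ n) (g r - a)| / 2 ≤
          (|g s - g r| / |g s - a|) ^ θ := by
        refine le_rpow_of_le_one_of_le (by positivity) hθ0.le hθ.le ?_ ?_
        · have := abs_sub (softSign (δ n) (g s - a)) (softSign (δ n) (g r - a))
          linarith [hss n (g s - a), hss n (g r - a)]
        · calc _ ≤ (2 * |g s - g r| / √((g s - a) ^ 2 + δ n)) / 2 := by gcongr
            _ = |g s - g r| / √((g s - a) ^ 2 + δ n) := by ring
            _ ≤ _ := by gcongr
      have h4 := div_rpow_le_of_holder (a := a) hC hθ0.le hg hr.2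
      rw [show ∀ x y : ℝ, A + D * x - (A + D * y) = D * (x - y) by intros; ring, abs_mul]
      calc _ = 2 * |D| * (|softSign (δ n) (g s - a) - softSign (δ n) (g r - a)| / 2) := by ring
        _ ≤ 2 * |D| * (C ^ θ * |g s - a| ^ (-θ) * (s - r) ^ (γ * θ)) := by
          gcongr
          exact h3.trans h4
        _ = _ := by ring)
    (by
      filter_upwards [hne] with s hs
      have h1 := ((tendsto_softSign (sub_ne_zero.2 hs)).const_mul D).const_add A
      convert h1 using 2
      split_ifs with hsa
      · rw [abs_of_nonneg (sub_nonneg.2 hsa), div_self (sub_ne_zero.2 hs)]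
        ring
      · rw [abs_of_neg (by linarith), div_neg, div_self (sub_ne_zero.2 hs)]
        ring)
    (fun _ => hg) (fun _ => tendsto_const_nhds)
  have hval : ∀ n, marchaudPairing β t (fun s => A + D * softSign (δ n) (g s - a)) g =
      (A * g t + D * √((g t - a) ^ 2 + δ n)) - (A * g 0 + D * √((g 0 - a) ^ 2 + δ n)) := by
    intro n
    have hd := contDiff_softSign (hδ0 n)
    have hsq : 0 < √(δ n) := Real.sqrt_pos.2 (hδ0 n)
    refine marchaudPairing_comp_eq (h := fun y => A + D * softSign (δ n) (y - a))
      (h' := fun y => D * deriv (softSign (δ n)) (y - a)) (M := |A| + |D|) (Λ := |D| * (2 / √(δ n)))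
      (F := fun y => A * y + D * √((y - a) ^ 2 + δ n)) hβ hγ ht hC hg (fun y => ?_) (fun y => ?_) ?_
      (fun y => ?_) (by positivity) (fun x y => ?_)
    · have h1 := (hasDerivAt_sqrt_sq_add (hδ0 n) (y - a)).comp_sub_const y a
      have h2 := ((hasDerivAt_id' y).const_mul A).add (h1.const_mul D)
      rw [mul_one] at h2
      exact h2
    · have h1 := ((hd.differentiable one_ne_zero).differentiableAt (x := y - a)).hasDerivAt.comp_sub_const y a
      exact (h1.const_mul D).const_add A
    · have := hd.continuous_deriv le_rfl
      fun_prop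
    · refine (abs_add_le _ _).trans ?_
      rw [abs_mul]
      have := mul_le_mul_of_nonneg_left (hss n (y - a)) (abs_nonneg D)
      linarith
    · rw [show ∀ x y : ℝ, A + D * x - (A + D * y) = D * (x - y) by intros; ring, abs_mul, mul_assoc]
      refine mul_le_mul_of_nonneg_left ?_ (abs_nonneg _)
      have h1 := abs_softSign_sub_le (hδ0 n) (x - a) (y - a)
      rw [sub_sub_sub_cancel_right] at h1
      refine h1.trans ?_
      have h2 : √(δ n) ≤ √((x - a) ^ 2 + δ n) := Real.sqrt_le_sqrt (by nlinarith [sq_nonneg (x - a)])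
      calc _ ≤ 2 * |x - y| / √(δ n) := by gcongr
        _ = _ := by ring
  simp only [hval] at hconv
  refine tendsto_nhds_unique hconv ?_
  have hsqrt : ∀ x : ℝ, Tendsto (fun n => √(x ^ 2 + δ n)) atTop (𝓝 |x|) := by
    intro x
    have h2 := (tendsto_one_div_add_atTop_nhds_zero_nat (𝕜 := ℝ)).const_add (x ^ 2)
    have h3 := (Real.continuous_sqrt.tendsto _).comp h2
    rw [add_zero, Real.sqrt_sq_eq_abs] at h3
    exact h3
  exact (((hsqrt _).const_mul D).const_add _).sub (((hsqrt _).const_mul D).const_add _)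

lemma leftLim_eq_of_continuousAt {g : ℝ → ℝ} {t : ℝ} (hg : ContinuousAt g t) :
    Function.leftLim g t = g t :=
  leftLim_eq_of_tendsto (hg.tendsto.mono_left nhdsWithin_le_nhds)

/-- A two-valued function of a Hölder path which spends little time near the level `a` is
Zähle-integrable against the path. -/
theorem hasZahleIntegral_step {β γ C t a c₁ c₂ : ℝ} {g : ℝ → ℝ} (hβ : β ∈ Set.Ioo (1 - γ) γ)
    (hγ : γ < 1) (ht : 0 < t) (hC : 0 ≤ C) (hg : ∀ s r, |g s - g r| ≤ C * |s - r| ^ γ)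
    (h : ∀ q ∈ Set.Ioo (0 : ℝ) 1, ∫⁻ s in Set.Icc 0 t, ENNReal.ofReal |g s - a| ^ (-q) ≠ ⊤) :
    HasZahleIntegral β 0 t (fun s => if a ≤ g s then c₁ else c₂) g
      (((c₁ + c₂) / 2 * g t + (c₁ - c₂) / 2 * |g t - a|) -
        ((c₁ + c₂) / 2 * g 0 + (c₁ - c₂) / 2 * |g 0 - a|)) := by
  have hβ' : β ∈ Set.Ioo (0 : ℝ) 1 := ⟨by linarith [hβ.1], hβ.2.trans hγ⟩
  have hγ0 : 0 < γ := by linarith [hβ.1, hβ.2]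
  have hgc := continuous_of_holder hγ0 hg
  obtain ⟨θ, hβθ, hθ⟩ := exists_between ((div_lt_one hγ0).2 hβ.2)
  have hβθ' : β < γ * θ := by rwa [div_lt_iff₀' hγ0] at hβθ
  have hθ0 : 0 < θ := (div_pos hβ'.1 hγ0).trans hβθ
  obtain ⟨m, hm, hm1⟩ := exists_between (max_lt hθ hγ)
  have hmθ : θ < m := (le_max_left _ _).trans_lt hm
  have hmγ : γ < m := (le_max_right _ _).trans_lt hm
  have hm0 : 0 < m := hγ0.trans hmγ
  have hp : 1 < m⁻¹ := (one_lt_inv₀ hm0).2 hm1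
  have hpθ : m⁻¹ * θ < 1 := by rwa [inv_mul_lt_iff₀ hm0, mul_one]
  have hpγ : m⁻¹ * γ < 1 := by rwa [inv_mul_lt_iff₀ hm0, mul_one]
  have hfm : Measurable fun s => if a ≤ g s then c₁ else c₂ :=
    Measurable.ite (measurableSet_le measurable_const hgc.measurable) measurable_const measurable_const
  have hne := ae_ne_of_lintegral_rpow_neg hgc.measurable hθ0 (h θ ⟨hθ0, hθ⟩)
  have hleft : HasLeftFracDeriv m⁻¹ β 0 t (fun s => if a ≤ g s then c₁ else c₂)
      (marchaudDeriv β fun s => if a ≤ g s then c₁ else c₂) := by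
    refine hasLeftFracDeriv_marchaudDeriv (M := |c₁| + |c₂|) (κ := γ * θ)
      (K := fun s => |c₁ - c₂| * C ^ θ * |g s - a| ^ (-θ)) hp hβ' hβθ' ?_ hfm (fun s _ => ?_)
      ?_ (fun s => by positivity) ?_
    · calc m⁻¹ * (γ * θ) ≤ m⁻¹ * (γ * 1) := by gcongr
        _ < 1 := by rwa [mul_one]
    · split_ifs <;> linarith [abs_nonneg c₁, abs_nonneg c₂]
    · exact (memLp_abs_sub_rpow_neg hgc.measurable (by positivity)
        (h _ ⟨by positivity, hpθ⟩) hθ0).const_mul _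
    · filter_upwards [hne] with s hs r hr
      refine (ite_sub_ite_abs_le hs hθ0.le).trans ?_
      have h4 := div_rpow_le_of_holder (a := a) hC hθ0.le hg hr.2
      calc _ ≤ |c₁ - c₂| * (C ^ θ * |g s - a| ^ (-θ) * (s - r) ^ (γ * θ)) := by gcongr
        _ = _ := by ring
  have hright : HasRightFracDeriv m⁻¹ (1 - β) 0 t (fun r => g r - g t)
      (fun s => marchaudDeriv (1 - β) (fun r => g (t - r) - g t) (t - s)) := by
    refine HasLeftFracDeriv.hasRightFracDeriv (g := fun r => g r - g t) ?_
    refine hasLeftFracDeriv_marchaudDeriv (M := C * t ^ γ) (κ := γ) (K := fun _ => C) hp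
      ⟨by linarith [hβ'.2], by linarith [hβ'.1]⟩ (by linarith [hβ.1]) hpγ (by fun_prop)
      (fun s hs => ?_) (memLp_const _) (fun _ => hC) (Eventually.of_forall fun s r hr => ?_)
    · refine (hg _ _).trans ?_
      rw [sub_sub_cancel_left, abs_neg, abs_of_nonneg hs.1]
      have := Real.rpow_le_rpow hs.1 hs.2 hγ0.le
      gcongr
    · have := hg (t - s) (t - r)
      rw [show t - s - (t - r) = -(s - r) by ring, abs_neg, abs_of_pos (sub_pos.2 hr.2)] at this
      simpa using this
  have hll : Function.leftLim g t = g t := leftLim_eq_of_continuousAt hgc.continuousAt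
  refine ⟨m⁻¹, hp, _, _, hleft, by rw [hll]; exact hright, ?_, ?_⟩
  · have h1 : IntegrableOn (marchaudDeriv β fun s => if a ≤ g s then c₁ else c₂) (Set.Icc 0 t) :=
      hleft.2.1.integrable (by rw [← ENNReal.ofReal_one]; exact ENNReal.ofReal_le_ofReal hp.le)
    refine Integrable.mul_bdd (c := (Real.Gamma β)⁻¹ * (C * (1 + (γ - (1 - β))⁻¹) * t ^ (γ - (1 - β))))
      h1 (measurable_marchaudDeriv_reflect hgc.measurable).aestronglyMeasurable ?_
    filter_upwards [ae_restrict_Icc_mem_Ioo t] with s hs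
    exact abs_marchaudDeriv_reflect_le hβ' (by linarith [hβ.1]) hC hg hs.1.le hs.2
  · exact (marchaudPairing_step_eq hβ hγ ht hC hg hθ hβθ' (h θ ⟨hθ0, hθ⟩)).symm

lemma HasZahleIntegral.congr {β t I : ℝ} {f f' g g' : ℝ → ℝ} (h : HasZahleIntegral β 0 t f g I)
    (hf : Set.EqOn f f' (Set.Icc 0 t)) (hg : Set.EqOn g g' (Set.Icc 0 t))
    (hlim : Function.leftLim g t = Function.leftLim g' t) : HasZahleIntegral β 0 t f' g' I := by
  obtain ⟨p, hp, φ, ψ, hφ, hψ, hint, hI⟩ := h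
  refine ⟨p, hp, φ, ψ, hφ.congr hf, hψ.congr fun s hs => ?_, hint, hI⟩
  simp only [hg hs, hlim]

lemma hasZahleIntegral_self (β : ℝ) (f g : ℝ → ℝ) : HasZahleIntegral β 0 0 f g 0 := by
  refine ⟨2, one_lt_two, 0, 0, ?_, ?_, by simp, by simp⟩
  · simp [HasLeftFracDeriv]
  · simp [HasRightFracDeriv]

lemma floor_two_mul (x : ℝ) (hx : 0 ≤ x) : ⌊2 * x⌋₊ = 2 * ⌊x⌋₊ ∨ ⌊2 * x⌋₊ = 2 * ⌊x⌋₊ + 1 := by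
  have h1 := Nat.floor_le hx
  have h2 := Nat.lt_floor_add_one x
  have h3 : 2 * ⌊x⌋₊ ≤ ⌊2 * x⌋₊ := Nat.le_floor (by push_cast; linarith)
  have h4 : ⌊2 * x⌋₊ < 2 * ⌊x⌋₊ + 2 :=
    (Nat.floor_lt (by linarith)).2 (by push_cast; linarith)
  omega

/-- Dyadic chaining: a continuous function on `[0, 1]` whose increments over dyadic intervals of
length `2⁻ⁿ` are at most `K 2^(-nγ)` is Hölder continuous of order `γ`. -/
theorem holder_of_dyadic {γ K : ℝ} (hγ : 0 < γ) {f : ℝ → ℝ} (hf : Continuous f)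
    (h : ∀ n k : ℕ, k < 2 ^ n →
      |f ((k + 1 : ℝ) / 2 ^ n) - f ((k : ℝ) / 2 ^ n)| ≤ K * ((2 : ℝ) ^ (-γ)) ^ n) :
    ∃ C, 0 ≤ C ∧ ∀ x ∈ Set.Icc (0 : ℝ) 1, ∀ y ∈ Set.Icc (0 : ℝ) 1, |f x - f y| ≤ C * |x - y| ^ γ := by
  set ρ : ℝ := (2 : ℝ) ^ (-γ) with hρ
  have hρ0 : 0 < ρ := Real.rpow_pos_of_pos two_pos _
  have hρ1 : ρ < 1 := Real.rpow_lt_one_of_one_lt_of_neg one_lt_two (by linarith)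
  have hK : 0 ≤ K := by
    have := (abs_nonneg _).trans (h 0 0 (by simp))
    simpa using this
  set d : ℕ → ℝ → ℝ := fun n x => (⌊2 ^ n * x⌋₊ : ℝ) / 2 ^ n with hd
  have hstep : ∀ x ∈ Set.Icc (0 : ℝ) 1, ∀ n, dist (f (d n x)) (f (d (n + 1) x)) ≤ K * ρ * ρ ^ n := by
    intro x hx n
    have hfl := floor_two_mul (2 ^ n * x) (mul_nonneg (by positivity) hx.1)
    rw [← mul_assoc, ← pow_succ'] at hfl
    have hpos : 0 ≤ K * ρ * ρ ^ n := by positivity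
    have hdn : d n x = ((2 * ⌊2 ^ n * x⌋₊ : ℕ) : ℝ) / 2 ^ (n + 1) := by
      simp only [hd]; push_cast; rw [pow_succ']; field_simp
    rcases hfl with hfl | hfl
    · have : d (n + 1) x = d n x := by rw [hdn]; simp only [hd, hfl]
      rw [this, dist_self]; exact hpos
    · have h1 : d (n + 1) x = (((2 * ⌊2 ^ n * x⌋₊ : ℕ) : ℝ) + 1) / 2 ^ (n + 1) := by
        simp only [hd, hfl]; push_cast; ring
      rw [hdn, h1, dist_comm, Real.dist_eq]
      have h2 : 2 * ⌊2 ^ n * x⌋₊ < 2 ^ (n + 1) := by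
        have h3 : ⌊2 ^ (n + 1) * x⌋₊ ≤ 2 ^ (n + 1) := by
          refine Nat.floor_le_of_le ?_
          push_cast
          exact mul_le_of_le_one_right (by positivity) hx.2
        omega
      refine (h (n + 1) _ h2).trans (le_of_eq ?_)
      rw [pow_succ']; ring
  have hdlim : ∀ x ∈ Set.Icc (0 : ℝ) 1, Tendsto (fun n => d n x) atTop (𝓝 x) := by
    intro x hx
    have h1 := (tendsto_nat_floor_mul_div_atTop (R := ℝ) hx.1).comp
      (tendsto_pow_atTop_atTop_of_one_lt (r := (2 : ℝ)) one_lt_two)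
    refine h1.congr fun n => ?_
    simp only [hd, Function.comp_apply]
    rw [mul_comm]
  have htail : ∀ x ∈ Set.Icc (0 : ℝ) 1, ∀ n, |f (d n x) - f x| ≤ K * ρ * ρ ^ n / (1 - ρ) :=
    fun x hx n => dist_le_of_le_geometric_of_tendsto ρ (K * ρ) hρ1 (hstep x hx)
      ((hf.tendsto x).comp (hdlim x hx)) n
  have h1ρ : 0 < 1 - ρ := by linarith
  set C := (K + 2 * (K * ρ / (1 - ρ))) * (2 : ℝ) ^ γ with hC
  have key : ∀ x ∈ Set.Icc (0 : ℝ) 1, ∀ y ∈ Set.Icc (0 : ℝ) 1, x < y →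
      |f x - f y| ≤ C * |x - y| ^ γ := by
    intro x hx y hy hxy
    obtain ⟨n, hn1, hn2⟩ := exists_nat_pow_near_of_lt_one (sub_pos.2 hxy)
      (show y - x ≤ 1 by linarith [hx.1, hy.2]) (y := (1 / 2 : ℝ)) (by norm_num) (by norm_num)
    have h2n : (0 : ℝ) < 2 ^ n := by positivity
    have hle : 2 ^ n * y ≤ 2 ^ n * x + 1 := by
      have : 2 ^ n * (y - x) ≤ 2 ^ n * (1 / 2) ^ n := by gcongr
      rw [← mul_pow] at this
      norm_num at this
      linarith
    have hmid : |f (d n x) - f (d n y)| ≤ K * ρ ^ n := by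
      have hx0 : 0 ≤ 2 ^ n * x := mul_nonneg h2n.le hx.1
      have hf1 : ⌊2 ^ n * x⌋₊ ≤ ⌊2 ^ n * y⌋₊ := Nat.floor_mono (by gcongr)
      have hf2 : ⌊2 ^ n * y⌋₊ ≤ ⌊2 ^ n * x⌋₊ + 1 := by
        rw [← Nat.floor_add_one hx0]
        exact Nat.floor_mono hle
      rcases Nat.eq_or_lt_of_le hf1 with he | he
      · simp only [hd, he, sub_self, abs_zero]
        positivity
      · have he' : ⌊2 ^ n * y⌋₊ = ⌊2 ^ n * x⌋₊ + 1 := by omega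
        have h3 : ⌊2 ^ n * y⌋₊ ≤ 2 ^ n := by
          refine Nat.floor_le_of_le ?_
          push_cast
          exact mul_le_of_le_one_right (by positivity) hy.2
        have := h n ⌊2 ^ n * x⌋₊ (by omega)
        rw [abs_sub_comm]
        simp only [hd, he']
        push_cast
        exact this
    have hρn : ρ ^ n ≤ (2 : ℝ) ^ γ * |x - y| ^ γ := by
      rw [abs_sub_comm, abs_of_pos (sub_pos.2 hxy), ← Real.mul_rpow two_pos.le (sub_pos.2 hxy).le]
      have h4 : ρ ^ n = ((1 / 2 : ℝ) ^ n) ^ γ := by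
        rw [hρ, Real.rpow_neg two_pos.le, ← Real.inv_rpow two_pos.le, ← Real.rpow_natCast,
          ← Real.rpow_natCast, ← Real.rpow_mul (by norm_num), ← Real.rpow_mul (by norm_num),
          mul_comm, one_div]
      rw [h4]
      refine Real.rpow_le_rpow (by positivity) ?_ hγ.le
      rw [pow_succ] at hn1
      linarith
    calc |f x - f y| = |-(f (d n x) - f x) + (f (d n x) - f (d n y)) + (f (d n y) - f y)| := by
          congr 1; ring
      _ ≤ |f (d n x) - f x| + |f (d n x) - f (d n y)| + |f (d n y) - f y| := by
          refine (abs_add_le _ _).trans (add_le_add_left ?_ _)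
          refine (abs_add_le _ _).trans (le_of_eq ?_)
          rw [abs_neg]
      _ ≤ K * ρ * ρ ^ n / (1 - ρ) + K * ρ ^ n + K * ρ * ρ ^ n / (1 - ρ) := by
          gcongr
          exacts [htail x hx n, htail y hy n]
      _ = (K + 2 * (K * ρ / (1 - ρ))) * ρ ^ n := by ring
      _ ≤ (K + 2 * (K * ρ / (1 - ρ))) * ((2 : ℝ) ^ γ * |x - y| ^ γ) := by gcongr
      _ = _ := by rw [hC]; ring
  refine ⟨C, by positivity, fun x hx y hy => ?_⟩
  rcases lt_trichotomy x y with hxy | rfl | hxy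
  · exact key x hx y hy hxy
  · simp [Real.zero_rpow hγ.ne']
  · rw [abs_sub_comm, abs_sub_comm x]
    exact key y hy x hx hxy

section

variable {Ω : Type*} [MeasurableSpace Ω] {P : Measure Ω} {H : ℝ} {B : ℝ≥0 → Ω → ℝ}

lemma lintegral_enorm_rpow_of_map_eq_gaussianReal {X : Ω → ℝ} (hX : AEMeasurable X P) {σ : ℝ}
    (hσ : 0 ≤ σ) (h : P.map X = gaussianReal 0 (σ ^ 2).toNNReal) {p : ℝ} (hp : 0 ≤ p) :
    ∫⁻ ω, ‖X ω‖ₑ ^ p ∂P = ENNReal.ofReal σ ^ p * ∫⁻ x, ‖x‖ₑ ^ p ∂(gaussianReal 0 1) := by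
  have h1 : ∫⁻ ω, ‖X ω‖ₑ ^ p ∂P = ∫⁻ x, ‖x‖ₑ ^ p ∂(P.map X) :=
    (lintegral_map' (f := fun x : ℝ => ‖x‖ₑ ^ p) (by fun_prop) hX).symm
  have h2 : gaussianReal 0 (σ ^ 2).toNNReal = (gaussianReal 0 1).map (fun x => σ * x) := by
    rw [gaussianReal_map_const_mul, mul_zero, mul_one]
    congr 1
    ext
    rw [Real.coe_toNNReal _ (sq_nonneg σ)]
    rfl
  rw [h1, h, h2, lintegral_map (by fun_prop) (by fun_prop), ← lintegral_const_mul _ (by fun_prop)]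
  refine lintegral_congr fun x => ?_
  rw [enorm_mul, ENNReal.mul_rpow_of_nonneg _ _ hp, Real.enorm_of_nonneg hσ]

lemma lintegral_enorm_rpow_gaussianReal_lt_top {p : ℝ} (hp : 0 < p) :
    ∫⁻ x, ‖x‖ₑ ^ p ∂(gaussianReal 0 1) < ⊤ := by
  have h := (memLp_id_gaussianReal' (μ := 0) (v := 1) (ENNReal.ofReal p) ENNReal.ofReal_ne_top).2
  rw [eLpNorm_lt_top_iff_lintegral_rpow_enorm_lt_top (by simpa using hp) (by simp),
    ENNReal.toReal_ofReal hp.le] at h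
  exact h

namespace IsFractionalBrownianMotion

lemma memLp_two (hB : IsFractionalBrownianMotion H B P) (t : ℝ≥0) : MemLp (B t) 2 P :=
  (hB.isGaussianProcess.hasGaussianLaw_eval t).memLp_two

lemma integral_sq (hB : IsFractionalBrownianMotion H B P) (hH : 0 < H) (t : ℝ≥0) :
    ∫ ω, B t ω ^ 2 ∂P = (t : ℝ) ^ (2 * H) := by
  have h := hB.integral_mul t t
  rw [sub_self, abs_zero, Real.zero_rpow (by positivity)] at h
  simp only [sq, h]
  ring

lemma map_sub (hB : IsFractionalBrownianMotion H B P) (hH : 0 < H) (s t : ℝ≥0) :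
    P.map (fun ω => B t ω - B s ω) =
      gaussianReal 0 ((|(t : ℝ) - s| ^ H) ^ 2).toNNReal := by
  have := hB.isGaussianProcess.isProbabilityMeasure
  have hg : HasGaussianLaw (fun ω => B t ω - B s ω) P := hB.isGaussianProcess.hasGaussianLaw_fun_sub
  have hi : ∀ r, Integrable (B r) P := fun r => (hB.memLp_two r).integrable one_le_two
  have hm : ∫ ω, (B t ω - B s ω) ∂P = 0 := by
    rw [integral_sub (hi t) (hi s), hB.integral_eq_zero, hB.integral_eq_zero, sub_zero]
  rw [hg.map_eq_gaussianReal, hm]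
  congr 2
  rw [variance_eq_integral hg.aemeasurable, hm]
  have h1 : ∀ ω, (B t ω - B s ω - 0) ^ 2 = B t ω ^ 2 + B s ω ^ 2 - 2 * (B t ω * B s ω) := by
    intro ω; ring
  have hmul : Integrable (fun ω => B t ω * B s ω) P := (hB.memLp_two t).integrable_mul (hB.memLp_two s)
  simp only [h1]
  have hadd : Integrable (fun ω => B t ω ^ 2 + B s ω ^ 2) P :=
    (hB.memLp_two t).integrable_sq.add (hB.memLp_two s).integrable_sq
  rw [integral_sub hadd (hmul.const_mul 2), integral_add (hB.memLp_two t).integrable_sq (hB.memLp_two s).integrable_sq,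
    integral_const_mul, hB.integral_mul s t, hB.integral_sq hH, hB.integral_sq hH,
    ← Real.rpow_natCast, ← Real.rpow_mul (abs_nonneg _), mul_comm H]
  push_cast
  ring

lemma map_eq (hB : IsFractionalBrownianMotion H B P) (hH : 0 < H) (t : ℝ≥0) :
    P.map (B t) = gaussianReal 0 (((t : ℝ) ^ H) ^ 2).toNNReal := by
  have hg := hB.isGaussianProcess.hasGaussianLaw_eval t
  rw [hg.map_eq_gaussianReal, variance_eq_integral hg.aemeasurable, hB.integral_eq_zero]
  simp only [sub_zero]
  rw [hB.integral_sq hH, ← Real.rpow_natCast, ← Real.rpow_mul t.coe_nonneg, mul_comm H]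
  push_cast
  rfl

lemma ae_eq_zero (hB : IsFractionalBrownianMotion H B P) (hH : 0 < H) : ∀ᵐ ω ∂P, B 0 ω = 0 := by
  have h := hB.integral_sq hH 0
  rw [NNReal.coe_zero, Real.zero_rpow (by positivity)] at h
  have h2 := (integral_eq_zero_iff_of_nonneg (fun ω => sq_nonneg (B 0 ω))
    (hB.memLp_two 0).integrable_sq).1 h
  filter_upwards [h2] with ω hω
  simpa using hω

/-- Kolmogorov's continuity estimate: paths are almost surely Hölder continuous of any order below
the Hurst parameter. -/
theorem ae_holder (hB : IsFractionalBrownianMotion H B P) {γ : ℝ} (hγ : 0 < γ) (hγH : γ < H)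
    {T : ℝ≥0} (hT : 0 < T) :
    ∀ᵐ ω ∂P, ∃ C, 0 ≤ C ∧ ∀ s ∈ Set.Icc 0 T, ∀ t ∈ Set.Icc 0 T,
      |B t ω - B s ω| ≤ C * |(t : ℝ) - s| ^ γ := by
  have hH : 0 < H := hγ.trans hγH
  set p : ℝ := 2 / (H - γ) with hp
  have hp0 : 0 < p := div_pos two_pos (sub_pos.2 hγH)
  have hpH : p * (H - γ) = 2 := div_mul_cancel₀ _ (sub_pos.2 hγH).ne'
  set τ : ℕ → ℕ → ℝ≥0 := fun n k => T * ((k : ℝ≥0) / 2 ^ n) with hτ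
  set c := ∫⁻ x, ‖x‖ₑ ^ p ∂(gaussianReal 0 1) with hc
  have hct : c < ⊤ := lintegral_enorm_rpow_gaussianReal_lt_top hp0
  set F : ℕ → ℕ → Ω → ℝ≥0∞ := fun n k ω =>
    (ENNReal.ofReal (((2 : ℝ) ^ γ) ^ n)) ^ p * ‖B (τ n (k + 1)) ω - B (τ n k) ω‖ₑ ^ p with hF
  have hmeas : ∀ s, AEMeasurable (B s) P := hB.isGaussianProcess.aemeasurable
  have hFm : ∀ n k, AEMeasurable (F n k) P := fun n k =>
    (((hmeas _).sub (hmeas _)).enorm.pow_const p).const_mul _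
  have hFi : ∀ n k, ∫⁻ ω, F n k ω ∂P = ENNReal.ofReal ((T : ℝ) ^ (H * p) *
      (((2 : ℝ)⁻¹) ^ n * ((2 : ℝ)⁻¹) ^ n)) * c := by
    intro n k
    have hd : |((τ n (k + 1) : ℝ≥0) : ℝ) - τ n k| = T / 2 ^ n := by
      simp only [hτ]
      push_cast
      rw [← mul_sub, ← sub_div, add_sub_cancel_left, mul_one_div, abs_of_nonneg (by positivity)]
    have h1 := hB.map_sub hH (τ n k) (τ n (k + 1))
    rw [hd] at h1
    have hT' : (0 : ℝ) < T := hT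
    simp only [hF]
    rw [lintegral_const_mul' _ _ (by simp [hp0.le]),
      lintegral_enorm_rpow_of_map_eq_gaussianReal
        (X := fun ω => B (τ n (k + 1)) ω - B (τ n k) ω) ((hmeas _).sub (hmeas _)) (by positivity) h1 hp0.le,
      ← mul_assoc, ENNReal.ofReal_rpow_of_nonneg (by positivity) hp0.le,
      ENNReal.ofReal_rpow_of_nonneg (by positivity) hp0.le, ← ENNReal.ofReal_mul (by positivity)]
    congr 2
    rw [Real.div_rpow hT'.le (by positivity), Real.div_rpow (by positivity) (by positivity),
      ← Real.rpow_mul hT'.le, mul_div_left_comm]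
    congr 1
    rw [← mul_pow, ← Real.rpow_natCast, ← Real.rpow_natCast, ← Real.rpow_natCast,
      ← Real.rpow_mul two_pos.le, ← Real.rpow_mul two_pos.le, ← Real.rpow_mul two_pos.le,
      ← Real.rpow_mul two_pos.le, ← Real.rpow_sub two_pos,
      show (2 : ℝ)⁻¹ * 2⁻¹ = 2 ^ (-2 : ℝ) by
        rw [Real.rpow_neg two_pos.le]; norm_num, ← Real.rpow_mul two_pos.le]
    congr 1
    linear_combination (-(n : ℝ)) * hpH
  have hsum : ∫⁻ ω, ∑' n, ∑ k ∈ Finset.range (2 ^ n), F n k ω ∂P ≠ ⊤ := by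
    rw [lintegral_tsum fun n => Finset.aemeasurable_fun_sum _ fun k _ => hFm n k]
    have h1 : ∀ n, ∫⁻ ω, ∑ k ∈ Finset.range (2 ^ n), F n k ω ∂P =
        ENNReal.ofReal ((T : ℝ) ^ (H * p)) * c * (2⁻¹ : ℝ≥0∞) ^ n := by
      intro n
      rw [lintegral_finsetSum' _ fun k _ => hFm n k]
      simp only [hFi, Finset.sum_const, Finset.card_range, nsmul_eq_mul]
      rw [ENNReal.ofReal_mul (by positivity), ENNReal.ofReal_mul (by positivity),
        ENNReal.ofReal_pow (by positivity), ENNReal.ofReal_inv_of_pos two_pos]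
      have h2 : (2 : ℝ≥0∞) ^ n * (2⁻¹ : ℝ≥0∞) ^ n = 1 := by
        rw [← mul_pow, ENNReal.mul_inv_cancel two_ne_zero ENNReal.ofNat_ne_top, one_pow]
      push_cast
      rw [ENNReal.ofReal_ofNat]
      calc _ = ((2 : ℝ≥0∞) ^ n * (2⁻¹ : ℝ≥0∞) ^ n) *
            (ENNReal.ofReal ((T : ℝ) ^ (H * p)) * c * (2⁻¹ : ℝ≥0∞) ^ n) := by ring
        _ = _ := by rw [h2, one_mul]
    simp only [h1]
    rw [ENNReal.tsum_mul_left, ENNReal.tsum_geometric]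
    refine ENNReal.mul_ne_top (ENNReal.mul_ne_top ENNReal.ofReal_ne_top hct.ne) ?_
    simp
  have hae := ae_lt_top' (AEMeasurable.tsum fun n =>
    Finset.aemeasurable_fun_sum (Finset.range (2 ^ n)) fun k _ => hFm n k) hsum
  filter_upwards [hae, hB.ae_continuous] with ω hω hcont
  set S := ∑' n, ∑ k ∈ Finset.range (2 ^ n), F n k ω with hS
  have hFS : ∀ n k, k < 2 ^ n → F n k ω ≤ S := fun n k hk =>
    (Finset.single_le_sum (f := fun k => F n k ω) (fun _ _ => zero_le)
      (Finset.mem_range.2 hk)).trans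
      (ENNReal.le_tsum (f := fun n => ∑ k ∈ Finset.range (2 ^ n), F n k ω) n)
  have hST : S ^ p⁻¹ ≠ ⊤ := ENNReal.rpow_ne_top_of_nonneg (inv_nonneg.2 hp0.le) hω.ne
  have hfc : Continuous fun x : ℝ => B (T * x.toNNReal) ω :=
    hcont.comp (continuous_const.mul continuous_real_toNNReal)
  obtain ⟨C, hC0, hC⟩ := holder_of_dyadic (K := (S ^ p⁻¹).toReal) hγ hfc fun n k hk => by
    have e1 : T * ((k + 1 : ℝ) / 2 ^ n).toNNReal = τ n (k + 1) := by
      simp only [hτ]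
      congr 1
      ext
      rw [Real.coe_toNNReal _ (by positivity)]
      push_cast
      rfl
    have e2 : T * ((k : ℝ) / 2 ^ n).toNNReal = τ n k := by
      simp only [hτ]
      congr 1
      ext
      rw [Real.coe_toNNReal _ (by positivity)]
      push_cast
      rfl
    rw [e1, e2]
    have h1 := hFS n k hk
    simp only [hF] at h1
    rw [← ENNReal.mul_rpow_of_nonneg _ _ hp0.le, ← Real.enorm_of_nonneg (by positivity), ← enorm_mul]
      at h1
    have h2 := ENNReal.rpow_le_rpow h1 (inv_nonneg.2 hp0.le)
    rw [← ENNReal.rpow_mul, mul_inv_cancel₀ hp0.ne', ENNReal.rpow_one] at h2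
    have h3 := ENNReal.toReal_mono hST h2
    rw [toReal_enorm, norm_mul, Real.norm_eq_abs, Real.norm_eq_abs, abs_of_nonneg (by positivity)] at h3
    rw [Real.rpow_neg two_pos.le, inv_pow, ← div_eq_mul_inv, le_div_iff₀ (by positivity), mul_comm]
    exact h3
  have hT' : (0 : ℝ) < T := hT
  refine ⟨C * ((T : ℝ)⁻¹) ^ γ, by positivity, fun s hs t ht => ?_⟩
  have hmem : ∀ r ∈ Set.Icc 0 T, (r : ℝ) / T ∈ Set.Icc (0 : ℝ) 1 := fun r hr =>
    ⟨by positivity, (div_le_one hT').2 hr.2⟩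
  have hval : ∀ r : ℝ≥0, T * ((r : ℝ) / T).toNNReal = r := fun r => by
    ext
    rw [NNReal.coe_mul, Real.coe_toNNReal _ (by positivity), mul_div_cancel₀ _ hT'.ne']
  have h1 := hC _ (hmem t ht) _ (hmem s hs)
  rw [hval, hval, ← sub_div, abs_div, abs_of_pos hT', div_eq_inv_mul,
    Real.mul_rpow (by positivity) (abs_nonneg _), ← mul_assoc] at h1
  exact h1

end IsFractionalBrownianMotion

lemma lintegral_abs_rpow_neg_lt_top {q : ℝ} (hq : q < 1) :
    ∫⁻ x in Set.Icc (-1 : ℝ) 1, ENNReal.ofReal |x| ^ (-q) < ⊤ := by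
  have h1 : IntervalIntegrable (fun x : ℝ => |x| ^ (-q)) volume 0 1 := by
    refine (intervalIntegral.intervalIntegrable_rpow' (a := 0) (b := 1) (r := -q) (by linarith)).congr
      fun x hx => ?_
    rw [Set.uIoc_of_le zero_le_one] at hx
    rw [abs_of_pos hx.1]
  have h2 : IntervalIntegrable (fun x : ℝ => |x| ^ (-q)) volume (-1) 0 := by
    have := h1.comp_sub_left 0
    simp only [zero_sub, abs_neg, sub_zero] at this
    exact this.symm
  have h3 := (intervalIntegrable_iff_integrableOn_Icc_of_le (by norm_num)).1 (h2.trans h1)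
  refine lt_of_eq_of_lt (lintegral_congr_ae ?_) h3.2
  have hne : ∀ᵐ r ∂((volume : Measure ℝ).restrict (Set.Icc (-1) 1)), r ≠ 0 :=
    ae_restrict_of_ae (by simp [ae_iff])
  filter_upwards [hne] with x hx
  rw [Real.enorm_of_nonneg (Real.rpow_nonneg (abs_nonneg _) _),
    ENNReal.ofReal_rpow_of_pos (abs_pos.2 hx)]

lemma lintegral_abs_sub_rpow_neg_gaussianReal_le {q : ℝ} (hq : 0 < q) (a : ℝ) {v : ℝ≥0} (hv : v ≠ 0) :
    ∫⁻ x, ENNReal.ofReal |x - a| ^ (-q) ∂(gaussianReal 0 v) ≤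
      1 + ENNReal.ofReal (√v)⁻¹ * ∫⁻ x in Set.Icc (-1 : ℝ) 1, ENNReal.ofReal |x| ^ (-q) := by
  set k : ℝ → ℝ≥0∞ := (Set.Icc (-1 : ℝ) 1).indicator fun x => ENNReal.ofReal |x| ^ (-q) with hk
  have hkm : Measurable k := Measurable.indicator (by fun_prop) measurableSet_Icc
  have hv0 : (0 : ℝ) < v := NNReal.coe_pos.2 (pos_iff_ne_zero.2 hv)
  rw [gaussianReal_of_var_ne_zero _ hv, lintegral_withDensity_eq_lintegral_mul _
    (measurable_gaussianPDF 0 v) (by fun_prop), ← lintegral_gaussianPDF_eq_one 0 hv,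
    ← lintegral_indicator measurableSet_Icc, ← hk, ← lintegral_sub_right_eq_self k a,
    ← lintegral_const_mul _ (by fun_prop),
    ← lintegral_add_left (measurable_gaussianPDF 0 v)]
  refine lintegral_mono fun x => ?_
  simp only [Pi.mul_apply]
  by_cases hx : x - a ∈ Set.Icc (-1 : ℝ) 1
  · rw [hk, Set.indicator_of_mem hx]
    refine le_add_left (mul_le_mul_left (ENNReal.ofReal_le_ofReal ?_) _)
    rw [gaussianPDFReal_def]
    have h1 : (√(2 * Real.pi * v))⁻¹ ≤ (√(v : ℝ))⁻¹ := by
      gcongr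
      nlinarith [Real.pi_gt_three]
    have h2 : Real.exp (-(x - 0) ^ 2 / (2 * v)) ≤ 1 := by
      rw [Real.exp_le_one_iff]
      exact div_nonpos_of_nonpos_of_nonneg (neg_nonpos.2 (sq_nonneg _)) (by positivity)
    calc _ ≤ (√(v : ℝ))⁻¹ * 1 := mul_le_mul h1 h2 (Real.exp_pos _).le (by positivity)
      _ = _ := mul_one _
  · rw [hk, Set.indicator_of_notMem hx, mul_zero, add_zero]
    refine mul_le_of_le_one_right' (ENNReal.rpow_le_one_of_one_le_of_neg ?_ (by linarith))
    rw [← ENNReal.ofReal_one]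
    refine ENNReal.ofReal_le_ofReal ?_
    by_contra h
    exact hx ⟨(abs_lt.1 (not_le.1 h)).1.le, (abs_lt.1 (not_le.1 h)).2.le⟩

/-- The path spends little time near any level `a`. -/
theorem IsFractionalBrownianMotion.ae_lintegral_rpow_neg_ne_top
    (hB : IsFractionalBrownianMotion H B P) (hH : 0 < H) (hH1 : H < 1) {q : ℝ} (hq : 0 < q)
    (hq1 : q < 1) (a T : ℝ) :
    ∀ᵐ ω ∂P, ∫⁻ s in Set.Icc 0 T, ENNReal.ofReal |B s.toNNReal ω - a| ^ (-q) ≠ ⊤ := by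
  have := hB.isGaussianProcess.isProbabilityMeasure
  have hmeas : ∀ s, AEMeasurable (B s) P := hB.isGaussianProcess.aemeasurable
  set τ : ℕ → ℕ → ℝ≥0 := fun n k => (k : ℝ≥0) / (n + 1 : ℝ≥0) with hτ
  have hmk : ∀ n k, ∃ Y : Ω → ℝ, Measurable Y ∧ B (τ n k) =ᵐ[P] Y := fun n k => hmeas (τ n k)
  choose B' hB'm hB'e using hmk
  set c := ∫⁻ x in Set.Icc (-1 : ℝ) 1, ENNReal.ofReal |x| ^ (-q) with hc
  have hct : c < ⊤ := lintegral_abs_rpow_neg_lt_top hq1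
  set ν : Measure ℝ := volume.restrict (Set.Icc 0 T) with hν
  set G : ℕ → Ω × ℝ → ℝ≥0∞ := fun n z =>
    ENNReal.ofReal |B' n ⌈z.2 * (n + 1 : ℝ)⌉₊ z.1 - a| ^ (-q) with hG
  have hGm : ∀ n, Measurable (G n) := by
    intro n
    have h1 : Measurable fun y : Ω × ℕ => ENNReal.ofReal |B' n y.2 y.1 - a| ^ (-q) :=
      measurable_from_prod_countable_left fun k => by
        have := hB'm n k
        simp only
        fun_prop
    have h2 : Measurable fun z : Ω × ℝ => (z.1, ⌈z.2 * (n + 1 : ℝ)⌉₊) :=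
      measurable_fst.prodMk (Nat.measurable_ceil.comp (measurable_snd.mul_const _))
    exact h1.comp h2
  have hbound : ∀ n, ∫⁻ z, G n z ∂(P.prod ν) ≤ ∫⁻ s in Set.Icc 0 T, (1 + ENNReal.ofReal (s ^ (-H)) * c) := by
    intro n
    rw [lintegral_prod_symm' _ (hGm n)]
    refine lintegral_mono_ae ?_
    filter_upwards [ae_restrict_Icc_mem_Ioo T] with s hs
    set k := ⌈s * (n + 1 : ℝ)⌉₊ with hk
    have hn : (0 : ℝ) < n + 1 := by positivity
    have hsτ : s ≤ τ n k := by
      simp only [hτ]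
      push_cast
      rw [le_div_iff₀ hn]
      exact Nat.le_ceil _
    have hτ0 : (0 : ℝ) < τ n k := hs.1.trans_le hsτ
    have h1 : ∫⁻ ω, G n (ω, s) ∂P =
        ∫⁻ x, ENNReal.ofReal |x - a| ^ (-q) ∂(gaussianReal 0 (((τ n k : ℝ) ^ H) ^ 2).toNNReal) := by
      rw [← hB.map_eq hH, lintegral_map' (by fun_prop) (hmeas _)]
      refine lintegral_congr_ae ?_
      filter_upwards [hB'e n k] with ω hω
      rw [hω]
    have hpos : 0 < ((τ n k : ℝ) ^ H) ^ 2 := by positivity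
    rw [h1]
    refine (lintegral_abs_sub_rpow_neg_gaussianReal_le hq a (Real.toNNReal_pos.2 hpos).ne').trans ?_
    gcongr
    rw [Real.coe_toNNReal _ hpos.le, Real.sqrt_sq (by positivity), ← Real.rpow_neg hτ0.le]
    exact Real.rpow_le_rpow_of_nonpos hs.1 hsτ (by linarith)
  have hfin : ∫⁻ s in Set.Icc 0 T, (1 + ENNReal.ofReal (s ^ (-H)) * c) < ⊤ := by
    rw [lintegral_add_left measurable_const, lintegral_mul_const _ (by fun_prop)]
    refine ENNReal.add_lt_top.2 ⟨by simp, ENNReal.mul_lt_top ?_ hct⟩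
    have h1 := (memLp_rpow_neg (p := 1) (κ := H) (t := T) one_pos (by rwa [one_mul]))
    rw [ENNReal.ofReal_one] at h1
    have h2 := (memLp_one_iff_integrable.1 h1).2
    refine lt_of_eq_of_lt (setLIntegral_congr_fun measurableSet_Icc fun s hs => ?_) h2
    exact (Real.enorm_of_nonneg (Real.rpow_nonneg hs.1 _)).symm
  have hlim : ∫⁻ z, liminf (fun n => G n z) atTop ∂(P.prod ν) < ⊤ :=
    ((lintegral_liminf_le hGm).trans (liminf_le_of_le (by isBoundedDefault)
      fun b hb => by
        obtain ⟨n, hn⟩ := hb.exists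
        exact hn.trans (hbound n))).trans_lt hfin
  have hLm : Measurable fun z => liminf (fun n => G n z) atTop := Measurable.liminf hGm
  rw [lintegral_prod _ hLm.aemeasurable] at hlim
  have hae := ae_lt_top (hLm.lintegral_prod_right' (ν := ν)) hlim.ne
  have heq : ∀ᵐ ω ∂P, ∀ n k, B (τ n k) ω = B' n k ω :=
    ae_all_iff.2 fun n => ae_all_iff.2 fun k => hB'e n k
  filter_upwards [hae, heq, hB.ae_continuous] with ω hω he hcont
  refine ne_of_lt (lt_of_eq_of_lt (setLIntegral_congr_fun measurableSet_Icc fun s hs => ?_) hω)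
  refine (Tendsto.liminf_eq ?_).symm
  have hτs : Tendsto (fun n => τ n ⌈s * (n + 1 : ℝ)⌉₊) atTop (𝓝 s.toNNReal) := by
    have h1 := (tendsto_nat_ceil_mul_div_atTop (R := ℝ) hs.1).comp
      (tendsto_natCast_atTop_atTop.comp (tendsto_add_atTop_nat 1))
    have h2 := (continuous_real_toNNReal.tendsto s).comp h1
    refine h2.congr fun n => ?_
    simp only [Function.comp_apply, hτ]
    ext
    rw [Real.coe_toNNReal _ (by positivity)]
    push_cast
    rfl
  have h3 : Continuous fun x : ℝ => ENNReal.ofReal |x - a| ^ (-q) :=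
    ENNReal.continuous_rpow_const.comp (ENNReal.continuous_ofReal.comp (by fun_prop))
  have h4 := ((h3.comp hcont).tendsto _).comp hτs
  refine h4.congr fun n => ?_
  simp only [Function.comp_apply, hG, he]

end

/-- The piecewise linear map `y ↦ y / α` on `[0, ∞)`, `y ↦ y / (1 - α)` on `(-∞, 0)`, which
straightens the equation with coefficient `skewCoeff α`. -/
noncomputable def skewMap (α y : ℝ) : ℝ :=
  (1 / α + 1 / (1 - α)) / 2 * y + (1 / α - 1 / (1 - α)) / 2 * |y|

lemma skewMap_of_nonneg (α : ℝ) {y : ℝ} (hy : 0 ≤ y) : skewMap α y = 1 / α * y := by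
  rw [skewMap, abs_of_nonneg hy]; ring

lemma skewMap_of_neg (α : ℝ) {y : ℝ} (hy : y < 0) : skewMap α y = 1 / (1 - α) * y := by
  rw [skewMap, abs_of_neg hy]; ring

lemma skewCoeff_skewMap {α : ℝ} (hα : α ∈ Set.Ioo (0 : ℝ) 1) (y : ℝ) :
    skewCoeff α (skewMap α y) = if 0 ≤ y then 1 / α else 1 / (1 - α) := by
  have h1 : 0 < 1 / α := one_div_pos.2 hα.1
  have h2 : 0 < 1 / (1 - α) := one_div_pos.2 (by linarith [hα.2])
  rw [skewCoeff]
  congr 1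
  rcases le_or_gt 0 y with hy | hy
  · rw [skewMap_of_nonneg α hy]
    exact propext ⟨fun _ => hy, fun _ => by positivity⟩
  · rw [skewMap_of_neg α hy]
    have := mul_neg_of_pos_of_neg h2 hy
    exact propext ⟨fun h => absurd h (not_le.2 this), fun h => absurd h (not_le.2 hy)⟩

lemma skewMap_surjective {α : ℝ} (hα : α ∈ Set.Ioo (0 : ℝ) 1) : Function.Surjective (skewMap α) := by
  intro x
  have h1 : 0 < 1 - α := by linarith [hα.2]
  rcases le_or_gt 0 x with hx | hx
  · refine ⟨α * x, ?_⟩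
    rw [skewMap_of_nonneg α (mul_nonneg hα.1.le hx), ← mul_assoc, one_div_mul_cancel hα.1.ne', one_mul]
  · refine ⟨(1 - α) * x, ?_⟩
    rw [skewMap_of_neg α (mul_neg_of_pos_of_neg h1 hx), ← mul_assoc, one_div_mul_cancel h1.ne', one_mul]

lemma exists_abs_skewMap_sub_le (α : ℝ) :
    ∃ L, 0 ≤ L ∧ ∀ y z, |skewMap α y - skewMap α z| ≤ L * |y - z| := by
  set A := (1 / α + 1 / (1 - α)) / 2 with hA
  set D := (1 / α - 1 / (1 - α)) / 2 with hD
  refine ⟨|A| + |D|, by positivity, fun y z => ?_⟩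
  have h : skewMap α y - skewMap α z = A * (y - z) + D * (|y| - |z|) := by
    rw [skewMap, skewMap]; ring
  rw [h, add_mul]
  refine (abs_add_le _ _).trans ?_
  rw [abs_mul, abs_mul]
  exact add_le_add_right (mul_le_mul_of_nonneg_left (abs_abs_sub_abs_le_abs_sub y z) (abs_nonneg _)) _

lemma measurable_skewMap (α : ℝ) : Measurable (skewMap α) := by
  unfold skewMap
  fun_prop

lemma holderOnWith_of_abs_sub_le {γ C : ℝ} (hγ : 0 ≤ γ) (hC : 0 ≤ C) {u : ℝ≥0 → ℝ} {S : Set ℝ≥0}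
    (h : ∀ s ∈ S, ∀ t ∈ S, |u t - u s| ≤ C * |(t : ℝ) - s| ^ γ) :
    HolderOnWith C.toNNReal γ.toNNReal u S := by
  intro t ht s hs
  rw [edist_dist, edist_dist, Real.dist_eq, NNReal.dist_eq, Real.coe_toNNReal _ hγ,
    ENNReal.ofReal_rpow_of_nonneg (abs_nonneg _) hγ]
  change _ ≤ ENNReal.ofReal C * _
  rw [← ENNReal.ofReal_mul hC]
  exact ENNReal.ofReal_le_ofReal (h s hs t ht)

lemma lintegral_rpow_neg_mono {μ : Measure ℝ} [IsFiniteMeasure μ] {φ : ℝ → ℝ≥0∞} {q q' : ℝ}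
    (hq : 0 < q) (hqq' : q ≤ q') (h : ∫⁻ s, φ s ^ (-q') ∂μ ≠ ⊤) : ∫⁻ s, φ s ^ (-q) ∂μ ≠ ⊤ := by
  refine ne_of_lt (lt_of_le_of_lt (b := ∫⁻ s, (1 + φ s ^ (-q')) ∂μ) (lintegral_mono fun s => ?_) ?_)
  · rcases le_total (φ s) 1 with h1 | h1
    · exact le_add_left (ENNReal.rpow_le_rpow_of_exponent_ge h1 (neg_le_neg hqq'))
    · exact le_add_right (ENNReal.rpow_le_one_of_one_le_of_neg h1 (by linarith))
  · rw [lintegral_add_left measurable_const]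
    exact ENNReal.add_lt_top.2 ⟨by simp, lt_top_iff_ne_top.2 h⟩

/-- The pathwise form of the existence theorem: along a Hölder path spending little time near the
level `-c`, the skew map of the path solves the equation. -/
theorem hasZahleIntegral_skewMap {α β γ C c : ℝ} (hα : α ∈ Set.Ioo (0 : ℝ) 1)
    (hβ : β ∈ Set.Ioo (1 - γ) γ) (hγ : γ < 1) (hC : 0 ≤ C) {T : ℝ≥0} {b : ℝ≥0 → ℝ}
    (hb : Continuous b)
    (hbC : ∀ s ∈ Set.Icc 0 T, ∀ t ∈ Set.Icc 0 T, |b t - b s| ≤ C * |(t : ℝ) - s| ^ γ)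
    (hocc : ∀ q ∈ Set.Ioo (0 : ℝ) 1,
      ∫⁻ s in Set.Icc 0 (T : ℝ), ENNReal.ofReal |b s.toNNReal - -c| ^ (-q) ≠ ⊤)
    {t : ℝ≥0} (ht : t ∈ Set.Icc 0 T) :
    HasZahleIntegral β 0 t (fun s => skewCoeff α (realPath (fun r => skewMap α (b r + c)) s))
      (realPath b) (skewMap α (b t + c) - skewMap α (b 0 + c)) := by
  have hγ0 : 0 < γ := by linarith [hβ.1, hβ.2]
  rcases ht.1.eq_or_lt with rfl | ht0
  · rw [sub_self, NNReal.coe_zero]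
    exact hasZahleIntegral_self _ _ _
  have ht0' : (0 : ℝ) < t := ht0
  set g : ℝ → ℝ := fun s => b (min s.toNNReal T) with hg
  have hgH : ∀ s r, |g s - g r| ≤ C * |s - r| ^ γ := by
    intro s r
    refine (hbC _ ⟨zero_le, min_le_right _ _⟩ _ ⟨zero_le, min_le_right _ _⟩).trans ?_
    have h1 : |((min s.toNNReal T : ℝ≥0) : ℝ) - (min r.toNNReal T : ℝ≥0)| ≤ |s - r| := by
      rw [NNReal.coe_min, NNReal.coe_min, Real.coe_toNNReal', Real.coe_toNNReal']
      exact (abs_min_sub_min_le_max _ _ _ _).trans (max_le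
        ((abs_max_sub_max_le_max _ _ _ _).trans (max_le le_rfl (by simp))) (by simp))
    have := Real.rpow_le_rpow (abs_nonneg _) h1 hγ0.le
    gcongr
  have hgb : Set.EqOn g (realPath b) (Set.Icc 0 (t : ℝ)) := by
    intro s hs
    simp only [hg, realPath]
    rw [min_eq_left]
    exact (Real.toNNReal_le_iff_le_coe.2 hs.2).trans ht.2
  have hrb : Continuous (realPath b) := hb.comp continuous_real_toNNReal
  have hocc' : ∀ q ∈ Set.Ioo (0 : ℝ) 1,
      ∫⁻ s in Set.Icc 0 (t : ℝ), ENNReal.ofReal |g s - -c| ^ (-q) ≠ ⊤ := by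
    intro q hq
    refine ne_top_of_le_ne_top (hocc q hq) ?_
    refine le_trans (le_of_eq (setLIntegral_congr_fun measurableSet_Icc fun s hs => ?_))
      (lintegral_mono_set (Set.Icc_subset_Icc_right (NNReal.coe_le_coe.2 ht.2)))
    simp only [hgb hs, realPath]
  have h := hasZahleIntegral_step (c₁ := 1 / α) (c₂ := 1 / (1 - α)) hβ hγ ht0' hC hgH hocc'
  have e0 : g 0 = b 0 := by
    rw [hgb ⟨le_rfl, ht0'.le⟩, realPath, Real.toNNReal_zero]
  have et : g t = b t := by
    rw [hgb ⟨ht0'.le, le_rfl⟩, realPath, Real.toNNReal_coe]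
  rw [e0, et] at h
  have h2 := h.congr (f' := fun s => skewCoeff α (realPath (fun r => skewMap α (b r + c)) s))
    (g' := realPath b) (fun s hs => ?_) hgb ?_
  · convert h2 using 1
    rw [skewMap, skewMap, sub_neg_eq_add, sub_neg_eq_add]
    ring
  · simp only
    rw [hgb hs]
    simp only [realPath, skewCoeff_skewMap hα, neg_le_iff_add_nonneg]
  · rw [leftLim_eq_of_continuousAt (continuous_of_holder hγ0 hgH).continuousAt,
      leftLim_eq_of_continuousAt hrb.continuousAt, hgb ⟨ht0'.le, le_rfl⟩]

theorem theorem1 {Ω : Type*} [MeasurableSpace Ω] (P : Measure Ω) [IsProbabilityMeasure P]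
    (H : ℝ) (hH : H ∈ Set.Ioo (1 / 2 : ℝ) 1)
    (B : ℝ≥0 → Ω → ℝ) (hB : IsFractionalBrownianMotion H B P)
    (α : ℝ) (hα : α ∈ Set.Ioo (0 : ℝ) 1) (x₀ : ℝ) (T : ℝ≥0) (hT : 0 < T)
    (γ : ℝ) (hγ : γ ∈ Set.Ioo (1 / 2 : ℝ) H) :
    ∃ x : ℝ≥0 → Ω → ℝ, (∀ t, AEMeasurable (x t) P) ∧
      ∀ᵐ ω ∂P,
        (∃ C : ℝ≥0, HolderOnWith C γ.toNNReal (fun t => x t ω) (Set.Icc 0 T)) ∧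
        ∀ β ∈ Set.Ioo (1 - γ) γ, ∀ t ∈ Set.Icc 0 T,
          ∃ I : ℝ,
            HasZahleIntegral β 0 t (fun s => skewCoeff α (realPath (fun r => x r ω) s))
              (realPath fun r => B r ω) I ∧
            x t ω = x₀ + I := by
  have hH0 : 0 < H := by linarith [hH.1]
  have hγ0 : 0 < γ := by linarith [hγ.1]
  obtain ⟨c, hc⟩ := skewMap_surjective hα x₀
  obtain ⟨L, hL0, hL⟩ := exists_abs_skewMap_sub_le α
  have hocc : ∀ᵐ ω ∂P, ∀ n : ℕ, ∫⁻ s in Set.Icc 0 (T : ℝ),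
      ENNReal.ofReal |B s.toNNReal ω - -c| ^ (-(1 - 1 / ((n : ℝ) + 2))) ≠ ⊤ := by
    refine ae_all_iff.2 fun n => ?_
    have h2 : (1 : ℝ) / (n + 2) < 1 := by
      rw [div_lt_one (by positivity)]
      linarith [n.cast_nonneg (α := ℝ)]
    have h3 : (0 : ℝ) < 1 / (n + 2) := by positivity
    exact hB.ae_lintegral_rpow_neg_ne_top hH0 hH.2 (by linarith) (by linarith) (-c) T
  refine ⟨fun t ω => skewMap α (B t ω + c), fun t => (measurable_skewMap α).comp_aemeasurable
    ((hB.isGaussianProcess.aemeasurable t).add_const c), ?_⟩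
  filter_upwards [hB.ae_holder hγ0 hγ.2 hT, hB.ae_continuous, hB.ae_eq_zero hH0, hocc]
    with ω ⟨C, hC0, hC⟩ hcont h0 hω
  refine ⟨⟨(L * C).toNNReal, holderOnWith_of_abs_sub_le hγ0.le (by positivity)
    fun s hs t ht => ?_⟩, fun β hβ t ht => ?_⟩
  · refine (hL _ _).trans ?_
    rw [add_sub_add_right_eq_sub, mul_assoc]
    exact mul_le_mul_of_nonneg_left (hC s hs t ht) hL0
  · refine ⟨_, hasZahleIntegral_skewMap (b := fun r => B r ω) hα hβ (hγ.2.trans hH.2) hC0 hcont hC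
      (fun q hq => ?_) ht, ?_⟩
    · obtain ⟨n, hn⟩ := exists_nat_one_div_lt (sub_pos.2 hq.2)
      refine lintegral_rpow_neg_mono hq.1 ?_ (hω n)
      have : 1 / ((n : ℝ) + 2) ≤ 1 / ((n : ℝ) + 1) := by gcongr; linarith
      linarith
    · rw [h0, zero_add, hc, add_sub_cancel]
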